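/- A JB$^*$-algebra is a complex Banach space $\mathcal{M}$ with a commutative Jordan product $\circ$ and a conjugate-linear multiplicative involution $*$ such that $\|x\circ y\|\le\|x\|\,\|y\|$, $\|x^*\|=\|x\|$ and $\|\{x,x^*,x\}\|=\|x\|^3$, where $\{x,y,z\}=(x\circ y)\circ z+(y\circ z)\circ x-(x\circ z)\circ y$. A JBW$^*$-algebra is a JB$^*$-algebra which is a dual Banach space; $\mathcal{M}_*$ denotes its predual, viewed as a closed subspace of the dual $\mathcal{M}^*$. A sub-JBW$^*$-algebra $\mathcal{N}$ of $\mathcal{M}$ is a weak* closed Jordan $*$-subalgebra; its predual $\mathcal{N}_*$ consists of the restrictions to $\mathcal{N}$ of the elements of $\mathcal{M}_*$. A normal faithful state on $\mathcal{M}$ is an element $\varphi\in\mathcal{M}_*$ of norm $1$ with $\varphi(x)\geq 0$ for each positive $x$ (that is, $x=y\circ y$ with $y=y^*$) and $\varphi(x)\neq 0$ if moreover $x\neq 0$. Given such a $\varphi$, the couple $(\mathcal{M},\mathcal{M}_*)$ is made compatible by the embedding $\mathcal{M}\to\mathcal{M}_*$, $x\mapsto\varphi_x$, where $\varphi_x(y)=\varphi(x\circ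 y)$. One sets $\mathrm{L}^1(\mathcal{M},\varphi)=\mathcal{M}_*$ and, for $1<p<\infty$, $\mathrm{L}^p(\mathcal{M},\varphi)=(\mathcal{M},\mathcal{M}_*)_{1/p}$ (complex interpolation). These spaces contain $\mathcal{M}$. Proposition. Let $\mathcal{M}$ be a JBW$^*$-algebra equipped with a normal faithful state $\varphi$. (1) Let $\alpha$ be a $*$-automorphism of $\mathcal{M}$ with $\varphi\circ\alpha=\varphi$. Then, for each $1\le p<\infty$, $\alpha$ extends to a surjective linear isometry $\alpha_p\colon\mathrm{L}^p(\mathcal{M},\varphi)\to\mathrm{L}^p(\mathcal{M},\varphi)$. (2) Let $\mathbb{E}\colon\mathcal{M}\to\mathcal{M}$ be a normal (weak* continuous) contractive linear projection onto a sub-JBW$^*$-algebra $\mathcal{N}$ with $\varphi\circ\mathbb{E}=\varphi$. Then, for each $1\le p<\infty$, $\mathbb{E}$ extends to a bounded linear projection $\mathbb{E}_p\colon\mathrm{L}^p(\mathcal{M},\varphi)\to\mathrm{L}^p(\mathcal{M},\varphi)$ whose range is linearly isometric to $\mathrm{L}^p(\mathcal{N},\varphi|_{\mathcal{N}})$. 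-/

import Mathlib

open scoped ZeroAtInfty Topology

noncomputable section

/-! ### Normed subspaces with their own norm -/

/-- A linear subspace of a complex vector space `V`, equipped with a norm of its own
(which need not be the restriction of a norm of `V`). -/
structure NormedSub (V : Type*) [AddCommGroup V] [Module ℂ V] where
  carrier : Submodule ℂ V
  nrm : Seminorm ℂ carrier
  definite : ∀ x, nrm x = 0 → x = 0

namespace NormedSub

variable {V : Type*} [AddCommGroup V] [Module ℂ V]

/-- The normed space underlying a `NormedSub`. -/
def Elem (W : NormedSub V) : Type _ := W.carrier

/-- The inclusion of a `NormedSub` in the surrounding vector space. -/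
def val {W : NormedSub V} (x : W.Elem) : V := Subtype.val (p := (· ∈ W.carrier)) x

instance (W : NormedSub V) : AddCommGroup W.Elem := inferInstanceAs (AddCommGroup W.carrier)

instance (W : NormedSub V) : Module ℂ W.Elem := inferInstanceAs (Module ℂ W.carrier)

instance (W : NormedSub V) : NormedAddCommGroup W.Elem :=
  AddGroupNorm.toNormedAddCommGroup
    { toFun := fun x => W.nrm x
      map_zero' := map_zero W.nrm
      add_le' := fun x y => map_add_le_add W.nrm x y
      neg' := fun x => map_neg_eq_map W.nrm x
      eq_zero_of_map_eq_zero' := W.definite }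

instance (W : NormedSub V) : NormedSpace ℂ W.Elem where
  norm_smul_le c x := (map_smul_eq_mul W.nrm c x).le

end NormedSub

/-! ### Complex interpolation -/

namespace Interp

variable {X₀ X₁ V : Type*} [NormedAddCommGroup X₀] [NormedSpace ℂ X₀]
  [NormedAddCommGroup X₁] [NormedSpace ℂ X₁] [NormedAddCommGroup V] [NormedSpace ℂ V]

/-- The map `(x₀, x₁) ↦ j₀ x₀ + j₁ x₁`, on the `ℓ¹`-direct sum of `X₀` and `X₁`. -/
def sumMap (j₀ : X₀ →L[ℂ] V) (j₁ : X₁ →L[ℂ] V) : WithLp 1 (X₀ × X₁) →L[ℂ] V :=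
  (j₀.coprod j₁).comp (WithLp.prodContinuousLinearEquiv 1 ℂ X₀ X₁).toContinuousLinearMap

/-- The sum `X₀ + X₁` inside `V` (`X₀`, `X₁` being embedded by `j₀`, `j₁`), realised as the
quotient of the `ℓ¹`-direct sum by the kernel of `(x₀, x₁) ↦ j₀ x₀ + j₁ x₁`. The quotient norm
is `‖x‖ = inf {‖x₀‖ + ‖x₁‖ : x = j₀ x₀ + j₁ x₁}`. -/
abbrev Sum (j₀ : X₀ →L[ℂ] V) (j₁ : X₁ →L[ℂ] V) : Type _ :=
  WithLp 1 (X₀ × X₁) ⧸ (sumMap j₀ j₁).ker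

instance (j₀ : X₀ →L[ℂ] V) (j₁ : X₁ →L[ℂ] V) :
    IsClosed ((sumMap j₀ j₁).ker : Set (WithLp 1 (X₀ × X₁))) :=
  (sumMap j₀ j₁).isClosed_ker

variable (j₀ : X₀ →L[ℂ] V) (j₁ : X₁ →L[ℂ] V)

/-- The embedding of `X₀` in `X₀ + X₁`. -/
def inl : X₀ →ₗ[ℂ] Sum j₀ j₁ :=
  (sumMap j₀ j₁).ker.mkQ ∘ₗ (WithLp.linearEquiv 1 ℂ (X₀ × X₁)).symm.toLinearMap ∘ₗ
    LinearMap.inl ℂ X₀ X₁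

/-- The embedding of `X₁` in `X₀ + X₁`. -/
def inr : X₁ →ₗ[ℂ] Sum j₀ j₁ :=
  (sumMap j₀ j₁).ker.mkQ ∘ₗ (WithLp.linearEquiv 1 ℂ (X₀ × X₁)).symm.toLinearMap ∘ₗ
    LinearMap.inr ℂ X₀ X₁

/-- The functions `f` of the Calderón family: bounded and continuous on the closed
strip with values in `X₀ + X₁`, holomorphic on the open strip, with boundary values
`g₀ t = f (i t)` and `g₁ t = f (1 + i t)` that are continuous and vanish at infinity in `X₀` and
in `X₁`, respectively. -/
structure IsAdmissible (f : ℂ → Sum j₀ j₁) (g₀ : C₀(ℝ, X₀)) (g₁ : C₀(ℝ, X₁)) : Prop where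
  continuousOn : ContinuousOn f {z | 0 ≤ z.re ∧ z.re ≤ 1}
  bounded : ∃ C : ℝ, ∀ z : ℂ, 0 ≤ z.re ∧ z.re ≤ 1 → ‖f z‖ ≤ C
  holomorphic : DifferentiableOn ℂ f {z | 0 < z.re ∧ z.re < 1}
  left : ∀ t : ℝ, f (t * Complex.I) = inl j₀ j₁ (g₀ t)
  right : ∀ t : ℝ, f (1 + t * Complex.I) = inr j₀ j₁ (g₁ t)

variable {j₀ j₁}

theorem norm_inl_le (x : X₀) : ‖inl j₀ j₁ x‖ ≤ ‖x‖ := by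
  refine (Submodule.Quotient.norm_mk_le _ _).trans ?_
  simp

theorem norm_inr_le (x : X₁) : ‖inr j₀ j₁ x‖ ≤ ‖x‖ := by
  refine (Submodule.Quotient.norm_mk_le _ _).trans ?_
  simp

theorem inr_injective (h : Function.Injective j₁) : Function.Injective (inr j₀ j₁) := by
  rw [← LinearMap.ker_eq_bot, LinearMap.ker_eq_bot']
  intro x hx
  have h2 := (Submodule.Quotient.mk_eq_zero _).1 hx
  apply h
  simpa [sumMap] using h2

namespace IsAdmissible

theorem zero : IsAdmissible j₀ j₁ (0 : ℂ → Sum j₀ j₁) 0 0 where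
  continuousOn := continuousOn_const
  bounded := ⟨0, by simp⟩
  holomorphic := differentiableOn_const 0
  left := by simp
  right := by simp

theorem add {f f' : ℂ → Sum j₀ j₁} {g₀ g₀' : C₀(ℝ, X₀)} {g₁ g₁' : C₀(ℝ, X₁)}
    (h : IsAdmissible j₀ j₁ f g₀ g₁) (h' : IsAdmissible j₀ j₁ f' g₀' g₁') :
    IsAdmissible j₀ j₁ (f + f') (g₀ + g₀') (g₁ + g₁') where
  continuousOn := h.continuousOn.add h'.continuousOn
  bounded := by
    obtain ⟨C, hC⟩ := h.bounded
    obtain ⟨C', hC'⟩ := h'.bounded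
    exact ⟨C + C', fun z hz => (norm_add_le _ _).trans (add_le_add (hC z hz) (hC' z hz))⟩
  holomorphic := h.holomorphic.add h'.holomorphic
  left t := by simp [h.left, h'.left]
  right t := by simp [h.right, h'.right]

theorem smul (c : ℂ) {f : ℂ → Sum j₀ j₁} {g₀ : C₀(ℝ, X₀)} {g₁ : C₀(ℝ, X₁)}
    (h : IsAdmissible j₀ j₁ f g₀ g₁) : IsAdmissible j₀ j₁ (c • f) (c • g₀) (c • g₁) where
  continuousOn := h.continuousOn.const_smul c
  bounded := by
    obtain ⟨C, hC⟩ := h.bounded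
    exact ⟨‖c‖ * C, fun z hz => by
      simpa [norm_smul] using mul_le_mul_of_nonneg_left (hC z hz) (norm_nonneg c)⟩
  holomorphic := h.holomorphic.const_smul c
  left t := by simp [h.left]
  right t := by simp [h.right]

theorem norm_le {f : ℂ → Sum j₀ j₁} {g₀ : C₀(ℝ, X₀)} {g₁ : C₀(ℝ, X₁)}
    (h : IsAdmissible j₀ j₁ f g₀ g₁) (θ : unitInterval) :
    ‖f ((θ : ℝ) : ℂ)‖ ≤ max ‖g₀‖ ‖g₁‖ := by
  obtain ⟨C, hC⟩ := h.bounded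
  have hcl : closure (Complex.re ⁻¹' Set.Ioo (0 : ℝ) 1) ⊆ {z | 0 ≤ z.re ∧ z.re ≤ 1} := by
    rw [Complex.closure_preimage_re, closure_Ioo (by norm_num)]
    exact fun z hz => hz
  refine PhragmenLindelof.vertical_strip (a := 0) (b := 1)
    ⟨h.holomorphic, h.continuousOn.mono hcl⟩ ⟨0, by positivity, 0, ?_⟩ ?_ ?_ ?_ ?_
  · simp only [zero_mul, Real.exp_zero]
    refine Asymptotics.IsBigO.of_bound C ?_
    refine Filter.Eventually.filter_mono inf_le_right ?_
    rw [Filter.eventually_principal]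
    intro z hz
    simpa using hC z ⟨hz.1.le, hz.2.le⟩
  · intro z hz
    have hz' : z = (z.im : ℂ) * Complex.I := by apply Complex.ext <;> simp [hz]
    rw [hz', h.left]
    exact (norm_inl_le _).trans ((g₀.toBCF.norm_coe_le_norm z.im).trans (le_max_left _ _))
  · intro z hz
    have hz' : z = 1 + (z.im : ℂ) * Complex.I := by apply Complex.ext <;> simp [hz]
    rw [hz', h.right]
    exact (norm_inr_le _).trans ((g₁.toBCF.norm_coe_le_norm z.im).trans (le_max_right _ _))
  · simpa using θ.2.1
  · simpa using θ.2.2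

end IsAdmissible

variable (j₀ j₁)

/-- The subspace `(X₀, X₁)_θ` of `X₀ + X₁`. -/
def space (θ : unitInterval) : Submodule ℂ (Sum j₀ j₁) where
  carrier := {x | ∃ f g₀ g₁, IsAdmissible j₀ j₁ f g₀ g₁ ∧ f ((θ : ℝ) : ℂ) = x}
  zero_mem' := ⟨0, 0, 0, IsAdmissible.zero, rfl⟩
  add_mem' := by
    rintro _ _ ⟨f, g₀, g₁, h, rfl⟩ ⟨f', g₀', g₁', h', rfl⟩
    exact ⟨_, _, _, h.add h', rfl⟩
  smul_mem' := by
    rintro c _ ⟨f, g₀, g₁, h, rfl⟩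
    exact ⟨_, _, _, h.smul c, rfl⟩

variable {j₀ j₁}

/-- The norms of the admissible functions `f` such that `f θ = x`. -/
def norms (θ : unitInterval) (x : Sum j₀ j₁) : Set ℝ :=
  {r | ∃ f g₀ g₁, IsAdmissible j₀ j₁ f g₀ g₁ ∧ f ((θ : ℝ) : ℂ) = x ∧
    r = max ‖g₀‖ ‖g₁‖}

/-- The interpolation norm of an element `x` of `(X₀, X₁)_θ`. -/
def interpNorm (θ : unitInterval) (x : Sum j₀ j₁) : ℝ := sInf (norms θ x)

theorem norms_bddBelow (θ : unitInterval) (x : Sum j₀ j₁) : BddBelow (norms θ x) :=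
  ⟨0, by rintro _ ⟨f, g₀, g₁, -, -, rfl⟩; positivity⟩

theorem norms_nonempty {θ : unitInterval} {x : Sum j₀ j₁} (hx : x ∈ space j₀ j₁ θ) :
    (norms θ x).Nonempty := by
  obtain ⟨f, g₀, g₁, h, hf⟩ := hx
  exact ⟨_, f, g₀, g₁, h, hf, rfl⟩

theorem norm_le_interpNorm {θ : unitInterval} {x : Sum j₀ j₁} (hx : x ∈ space j₀ j₁ θ) :
    ‖x‖ ≤ interpNorm θ x := by
  refine le_csInf (norms_nonempty hx) ?_
  rintro _ ⟨f, g₀, g₁, h, rfl, rfl⟩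
  exact h.norm_le θ

theorem interpNorm_add {θ : unitInterval} {x y : Sum j₀ j₁} (hx : x ∈ space j₀ j₁ θ)
    (hy : y ∈ space j₀ j₁ θ) : interpNorm θ (x + y) ≤ interpNorm θ x + interpNorm θ y := by
  refine le_of_forall_pos_le_add fun ε hε => ?_
  obtain ⟨_, ⟨f, g₀, g₁, h, hf, rfl⟩, hr⟩ :=
    Real.lt_sInf_add_pos (norms_nonempty hx) (half_pos hε)
  obtain ⟨_, ⟨f', g₀', g₁', h', hf', rfl⟩, hr'⟩ :=
    Real.lt_sInf_add_pos (norms_nonempty hy) (half_pos hε)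
  have h1 : interpNorm θ (x + y) ≤ max ‖g₀ + g₀'‖ ‖g₁ + g₁'‖ :=
    csInf_le (norms_bddBelow _ _) ⟨_, _, _, h.add h', by simp [hf, hf'], rfl⟩
  have h2 : max ‖g₀ + g₀'‖ ‖g₁ + g₁'‖ ≤ max ‖g₀‖ ‖g₁‖ + max ‖g₀'‖ ‖g₁'‖ :=
    max_le ((norm_add_le _ _).trans (add_le_add (le_max_left _ _) (le_max_left _ _)))
      ((norm_add_le _ _).trans (add_le_add (le_max_right _ _) (le_max_right _ _)))
  unfold interpNorm at *
  linarith

theorem interpNorm_smul_le {θ : unitInterval} {x : Sum j₀ j₁} (c : ℂ) (hx : x ∈ space j₀ j₁ θ) :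
    interpNorm θ (c • x) ≤ ‖c‖ * interpNorm θ x := by
  rw [interpNorm, interpNorm, ← smul_eq_mul, ← Real.sInf_smul_of_nonneg (norm_nonneg c)]
  refine le_csInf ((norms_nonempty hx).smul_set) ?_
  rintro _ ⟨_, ⟨f, g₀, g₁, h, hf, rfl⟩, rfl⟩
  refine csInf_le (norms_bddBelow _ _) ⟨_, _, _, h.smul c, by simp [hf], ?_⟩
  simp only [norm_smul, smul_eq_mul]
  exact (mul_max_of_nonneg _ _ (norm_nonneg c))

variable (j₀ j₁)

/-- The complex interpolation space `(X₀, X₁)_θ` with its norm. -/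
def interp (θ : unitInterval) : NormedSub (Sum j₀ j₁) where
  carrier := space j₀ j₁ θ
  nrm := Seminorm.ofSMulLE (fun x => interpNorm θ (x : Sum j₀ j₁))
    (by
      refine le_antisymm ?_ (le_trans (norm_nonneg (0 : Sum j₀ j₁)) (norm_le_interpNorm (Submodule.zero_mem _)))
      exact csInf_le (norms_bddBelow _ _) ⟨0, 0, 0, IsAdmissible.zero, rfl, by simp⟩)
    (fun x y => interpNorm_add x.2 y.2)
    (fun c x => interpNorm_smul_le c x.2)
  definite x hx := by
    have h := norm_le_interpNorm x.2
    have h2 : interpNorm θ (x : Sum j₀ j₁) = 0 := hx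
    rw [h2, norm_le_zero_iff] at h
    exact Subtype.ext h

/-- The space `X₁` with its own norm, as a subspace of `X₀ + X₁`. -/
def right (h : Function.Injective j₁) : NormedSub (Sum j₀ j₁) where
  carrier := LinearMap.range (inr j₀ j₁)
  nrm := (normSeminorm ℂ X₁).comp
    (LinearEquiv.ofInjective (inr j₀ j₁) (inr_injective h)).symm.toLinearMap
  definite x hx := by simpa using hx

end Interp

/-! ### JB*-algebras and JBW*-algebras -/

/-- A JB*-algebra, the Jordan product being written `x * y`. -/
class JBStarAlgebra (A : Type*) extends NormedAddCommGroup A, NonUnitalNonAssocCommRing A,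
    StarRing A, CompleteSpace A, NormedSpace ℂ A, IsScalarTower ℂ A A, SMulCommClass ℂ A A,
    StarModule ℂ A, IsCommJordan A where
  norm_jmul_le : ∀ x y : A, ‖x * y‖ ≤ ‖x‖ * ‖y‖
  norm_jstar : ∀ x : A, ‖star x‖ = ‖x‖
  /-- `‖{x, x*, x}‖ = ‖x‖³` where `{x, y, z} = (x ∘ y) ∘ z + (y ∘ z) ∘ x - (x ∘ z) ∘ y`. -/
  norm_triple : ∀ x : A,
    ‖(x * star x) * x + (star x * x) * x - (x * x) * star x‖ = ‖x‖ ^ 3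

section Predual

variable {X : Type*} [NormedAddCommGroup X] [NormedSpace ℂ X]

/-- A subspace of the dual of `X`, as a normed space with the norm of the dual. -/
def Pre (F : Submodule ℂ (StrongDual ℂ X)) : Type _ := F

instance (F : Submodule ℂ (StrongDual ℂ X)) : NormedAddCommGroup (Pre F) :=
  inferInstanceAs (NormedAddCommGroup F)

instance (F : Submodule ℂ (StrongDual ℂ X)) : NormedSpace ℂ (Pre F) :=
  inferInstanceAs (NormedSpace ℂ F)

/-- The inclusion of a subspace of the dual in the dual. -/
def Pre.toDual (F : Submodule ℂ (StrongDual ℂ X)) : Pre F →L[ℂ] StrongDual ℂ X :=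
  LinearMap.mkContinuous
    { toFun := fun ψ => Subtype.val (p := (· ∈ F)) ψ
      map_add' := fun _ _ => rfl
      map_smul' := fun _ _ => rfl } 1 (fun ψ => (one_mul ‖ψ‖).ge)

theorem Pre.toDual_injective (F : Submodule ℂ (StrongDual ℂ X)) :
    Function.Injective (Pre.toDual F) := Subtype.val_injective

/-- A closed subspace `F` of the dual of a Banach space `X` is a predual of `X` if the evaluation
map `X → F*`, `x ↦ (ψ ↦ ψ x)`, is isometric and onto. -/
structure IsPredual (F : Submodule ℂ (StrongDual ℂ X)) : Prop where
  isClosed : IsClosed (F : Set (StrongDual ℂ X))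
  isometry : ∀ x : X, ‖(Pre.toDual F).flip x‖ = ‖x‖
  surjective : Function.Surjective (Pre.toDual F).flip

/-- The weak* topology on `X` that is defined by a predual `F`. -/
abbrev weakStar (F : Submodule ℂ (StrongDual ℂ X)) : TopologicalSpace X :=
  TopologicalSpace.induced (fun x (ψ : F) => (ψ : StrongDual ℂ X) x) Pi.topologicalSpace

end Predual

section JB

variable {M : Type*} [JBStarAlgebra M]

/-- A normal faithful state (with respect to the predual `F`): an element `φ` of the predual of
norm one which is nonnegative on the positive elements, that is on the squares of the selfadjoint
elements, and which vanishes at no nonzero positive element. -/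
structure IsNormalFaithfulState (F : Submodule ℂ (StrongDual ℂ M)) (φ : StrongDual ℂ M) :
    Prop where
  normal : φ ∈ F
  norm_eq_one : ‖φ‖ = 1
  nonneg : ∀ y : M, IsSelfAdjoint y → 0 ≤ (φ (y * y)).re ∧ (φ (y * y)).im = 0
  faithful : ∀ y : M, IsSelfAdjoint y → φ (y * y) = 0 → y * y = 0

/-- The map `x ↦ φ_x`, where `φ_x y = φ (x ∘ y)`, with values in the dual of `M`. -/
def jtranslate (φ : StrongDual ℂ M) : M →L[ℂ] StrongDual ℂ M :=
  LinearMap.mkContinuous₂ ((LinearMap.mul ℂ M).compr₂ (φ : M →ₗ[ℂ] ℂ)) ‖φ‖ fun x y =>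
    (φ.le_opNorm _).trans (by
      rw [mul_assoc]
      exact mul_le_mul_of_nonneg_left (JBStarAlgebra.norm_jmul_le x y) (norm_nonneg φ))

/-- The sum `M + M_*` for the couple `(M, M_*)`, where `F = M_*` is the predual; both spaces are
embedded in the dual of `M`, the algebra `M` by `x ↦ φ_x` and `F` by inclusion. -/
abbrev LSum (F : Submodule ℂ (StrongDual ℂ M)) (φ : StrongDual ℂ M) : Type _ :=
  Interp.Sum (jtranslate φ) (Pre.toDual F)

/-- The image in `M + M_*` of an element of `M`. -/
def ofAlg (F : Submodule ℂ (StrongDual ℂ M)) (φ : StrongDual ℂ M) (x : M) : LSum F φ :=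
  Interp.inl (jtranslate φ) (Pre.toDual F) x

open Classical in
/-- The nonassociative space `L^p(M, φ)`: the predual `F = M_*` if `p = 1` and the
interpolation space `(M, M_*)_{1/p}` if `1 < p < ∞`. -/
def LpSub (F : Submodule ℂ (StrongDual ℂ M)) (φ : StrongDual ℂ M) (p : ℝ) (hp : 1 ≤ p) :
    NormedSub (LSum F φ) :=
  if p = 1 then Interp.right (jtranslate φ) (Pre.toDual F) (Pre.toDual_injective F)
  else Interp.interp (jtranslate φ) (Pre.toDual F)
    ⟨1 / p, by positivity, by rw [one_div]; exact inv_le_one_of_one_le₀ hp⟩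

/-- `L^p(M, φ)` as a normed space. -/
abbrev JLp (F : Submodule ℂ (StrongDual ℂ M)) (φ : StrongDual ℂ M) (p : ℝ) (hp : 1 ≤ p) :
    Type _ := (LpSub F φ p hp).Elem

/-- A map `S` on `L^p(M, φ)` is induced by the map `T` on `M` if `M` is contained in
`L^p(M, φ)` and `S` extends `T`. -/
def Induces (F : Submodule ℂ (StrongDual ℂ M)) (φ : StrongDual ℂ M) (p : ℝ) (hp : 1 ≤ p)
    (T : M → M) (S : JLp F φ p hp → JLp F φ p hp) : Prop :=
  ∀ x : M, ∃ h : JLp F φ p hp, h.val = ofAlg F φ x ∧ (S h).val = ofAlg F φ (T x)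

/-- A JBW*-subalgebra: a weak* closed Jordan *-subalgebra. -/
structure JBWStarSubalgebra (F : Submodule ℂ (StrongDual ℂ M)) extends
    NonUnitalStarSubalgebra ℂ M where
  weakStarClosed : IsClosed[weakStar F] carrier

namespace JBWStarSubalgebra

variable {F : Submodule ℂ (StrongDual ℂ M)}

theorem isClosed (N : JBWStarSubalgebra F) :
    IsClosed (N.toNonUnitalStarSubalgebra : Set M) := by
  have hc : Continuous (fun (x : M) (ψ : F) => (ψ : StrongDual ℂ M) x) :=
    continuous_pi fun ψ => (ψ : StrongDual ℂ M).continuous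
  exact N.weakStarClosed.mono (continuous_iff_le_induced.1 hc)

/-- The underlying subspace. -/
abbrev toSub (N : JBWStarSubalgebra F) : Submodule ℂ M :=
  N.toNonUnitalStarSubalgebra.toNonUnitalSubalgebra.toSubmodule

/-- The JB*-algebra underlying a JBW*-subalgebra, with the restricted operations and norm. -/
abbrev Elem (N : JBWStarSubalgebra F) : Type _ := N.toSub

instance (N : JBWStarSubalgebra F) : JBStarAlgebra N.Elem where
  mul x y := ⟨x * y, N.mul_mem' x.2 y.2⟩
  left_distrib x y z := Subtype.ext (mul_add (x : M) y z)
  right_distrib x y z := Subtype.ext (add_mul (x : M) y z)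
  zero_mul x := Subtype.ext (zero_mul (x : M))
  mul_zero x := Subtype.ext (mul_zero (x : M))
  mul_comm x y := Subtype.ext (mul_comm (x : M) y)
  star x := ⟨star (x : M), N.star_mem' x.2⟩
  star_involutive x := Subtype.ext (star_star (x : M))
  star_mul x y := Subtype.ext (star_mul (x : M) y)
  star_add x y := Subtype.ext (star_add (x : M) y)
  complete := (N.isClosed.completeSpace_coe : CompleteSpace N.toSub).complete
  norm_smul_le c x := norm_smul_le c (x : M)
  smul_assoc c x y := Subtype.ext (smul_mul_assoc c (x : M) y)
  smul_comm c x y := Subtype.ext (mul_smul_comm c (x : M) (y : M)).symm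
  star_smul c x := Subtype.ext (star_smul c (x : M))
  lmul_comm_rmul_rmul x y := Subtype.ext (IsCommJordan.lmul_comm_rmul_rmul (x : M) y)
  norm_jmul_le x y := JBStarAlgebra.norm_jmul_le (x : M) y
  norm_jstar x := JBStarAlgebra.norm_jstar (x : M)
  norm_triple x := JBStarAlgebra.norm_triple (x : M)

/-- The inclusion of a JBW*-subalgebra. -/
def incl (N : JBWStarSubalgebra F) : N.Elem →L[ℂ] M := N.toSub.subtypeL

/-- The predual of a JBW*-subalgebra `N` of `M`: the restrictions to `N` of the elements of the
predual of `M`, that is the functionals on `N` that are continuous for the weak* topology. Its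
norm is that of the dual of `N`. -/
def predual (N : JBWStarSubalgebra F) : Submodule ℂ (StrongDual ℂ N.Elem) :=
  F.map (ContinuousLinearMap.precomp ℂ N.incl).toLinearMap

end JBWStarSubalgebra

/-- A normal contractive projection of `M` onto the JBW*-subalgebra `N`. Normal means weak*
continuous, that is, composition with `E` maps the predual into itself. -/
structure IsNormalContractiveProj (F : Submodule ℂ (StrongDual ℂ M)) (E : M →L[ℂ] M)
    (N : JBWStarSubalgebra F) : Prop where
  idem : ∀ x, E (E x) = E x
  contractive : ∀ x, ‖E x‖ ≤ ‖x‖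
  normal : ∀ ψ ∈ F, ψ.comp E ∈ F
  range_eq : Set.range E = N.carrier

end JB

end

/-!
A faithful state `φ` in the predual attains its norm, and a point where it does yields an
idempotent, which faithfulness forces to be a unit of `M`. In a unital JB*-algebra a contractive
projection `E` whose range is a subalgebra containing the unit is a module map over its range: for a
selfadjoint `n` in the range and real `t`, the maps `exp (i t L_n)` are isometries, and
`exp (t L_n)` is positive, so that `exp (-t L_n) E exp (t L_n)` is positive and unital. The function
`z ↦ exp (-z L_n) (E (exp (z L_n) k))` is therefore bounded, hence constant. Applied to the limit
along an ultrafilter, a contractive projection of the algebra of bounded families onto the constant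
ones, this shows that the Jordan multiplication is separately weak* continuous.

Therefore the functionals `φ_x : y ↦ φ (x * y)` belong to the predual. They are dense in it because
`φ` is faithful, so a bounded map that has an adjoint for the bilinear form `φ (x * y)` is weak*
continuous. A state preserving automorphism has its inverse as adjoint, and a state preserving
projection `E` onto `N` is adjoint to the inclusion of `N`. A contraction on the algebra and the
transpose of its adjoint on the predual form a contractive morphism of couples, which acts
contractively on the interpolation spaces. Mutually inverse pairs give isometries, and an inclusion
with its retraction gives a projection whose range is isometric to the `L^p` space of `N`.
-/

open NormedSpace (exp)
open scoped ComplexStarModule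

section JordanIdentities

variable {A : Type*} [NonUnitalNonAssocCommRing A] [IsCommJordan A] [IsAddTorsionFree A]

theorem jordan_linearized (a b c d : A) :
    a * (b * c * d) + b * (c * a * d) + c * (a * b * d) =
      b * c * (a * d) + c * a * (b * d) + a * b * (c * d) := by
  have h := DFunLike.congr_fun (two_nsmul_lie_lmul_lmul_add_add_eq_zero a b c) d
  have h' := (smul_eq_zero_iff_right two_ne_zero).1 h
  simp only [Ring.lie_def] at h'
  rw [← sub_eq_zero, ← h']
  change _ = (a * (b * c * d) - b * c * (a * d)) + (b * (c * a * d) - c * a * (b * d)) +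
      (c * (a * b * d) - a * b * (c * d))
  abel

theorem jordan_mul_mul_mul (a b y : A) :
    a * (a * b) * y =
      2 • (a * (a * b * y)) + b * (a * a * y) - b * (a * (a * y)) - a * (a * (b * y)) := by
  have h1 := jordan_linearized a b a y
  have h2 := jordan_linearized y b a a
  simp only [mul_comm] at h1 h2 ⊢
  linear_combination (norm := module) h2 - h1

/-- `L_a {x, y, x} = {L_a x, y, x} + {x, y, L_a x} - {x, L_a y, x}`, so that `exp (i L_a)`
preserves `{x, x*, x}` when `a` is selfadjoint. -/
theorem mul_triple (a x y : A) :
    a * (x * y * x + y * x * x - x * x * y) =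
      (a * x * y * x + y * x * (a * x) - a * x * x * y) +
      (x * y * (a * x) + y * (a * x) * x - x * (a * x) * y) -
      (x * (a * y) * x + a * y * x * x - x * x * (a * y)) := by
  have h1 := jordan_linearized a x y x
  have h2 := jordan_linearized a x x y
  simp only [mul_add, mul_sub, mul_comm] at h1 h2 ⊢
  linear_combination (norm := module) (2 : ℤ) • h1 - h2

/-- The powers of an element, with the index shifted by one because there need not be a unit:
`jpow a n` is `a ^ (n + 1)`. -/
def jpow (a : A) : ℕ → A
  | 0 => a
  | n + 1 => a * jpow a n

open AddMonoid.End (mulLeft)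

theorem mulLeft_jpow_add_two (a : A) (n : ℕ) :
    mulLeft (jpow a (n + 2)) =
      2 • (mulLeft a * mulLeft (jpow a (n + 1))) + mulLeft (jpow a n) * mulLeft (a * a) -
        mulLeft (jpow a n) * (mulLeft a * mulLeft a) -
        mulLeft a * (mulLeft a * mulLeft (jpow a n)) :=
  AddMonoidHom.ext fun y => jordan_mul_mul_mul a (jpow a n) y

theorem commute_mulLeft_jpow {a : A} {T : AddMonoid.End A} (h : Commute T (mulLeft a))
    (h' : Commute T (mulLeft (a * a))) (n : ℕ) : Commute T (mulLeft (jpow a n)) := by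
  induction n using Nat.twoStepInduction with
  | zero => exact h
  | one => exact h'
  | more n ih ih' =>
    rw [mulLeft_jpow_add_two]
    exact ((((h.mul_right ih').smul_right 2).add_right (ih.mul_right h')).sub_right
      (ih.mul_right (h.mul_right h))).sub_right (h.mul_right (h.mul_right ih))

theorem jpow_mul_jpow (a : A) (m n : ℕ) : jpow a m * jpow a n = jpow a (m + n + 1) := by
  induction m with
  | zero => rw [zero_add]; rfl
  | succ m ih =>
    have hcomm : jpow a n * (a * jpow a m) = a * (jpow a n * jpow a m) :=
      DFunLike.congr_fun (commute_mulLeft_jpow (.refl _) (commute_lmul_lmul_sq a) n).symm.eq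
        (jpow a m)
    calc jpow a (m + 1) * jpow a n = jpow a n * (a * jpow a m) := mul_comm _ _
      _ = a * jpow a (m + n + 1) := by rw [hcomm, mul_comm (jpow a n), ih]
      _ = jpow a (m + 1 + n + 1) := by rw [add_right_comm m 1 n]; rfl

section Peirce

variable {e : A}

theorem peirce_identity (he : e * e = e) (x : A) :
    2 • (e * (e * (e * x))) - 3 • (e * (e * x)) + e * x = 0 := by
  have h := jordan_linearized e e x e
  rw [he, he, mul_comm x e, mul_comm (e * x) e] at h
  linear_combination (norm := module) h

theorem peirce_zero_mul_self (he : e * e = e) {y : A} (hy : e * y = 0) : e * (y * y) = 0 := by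
  have h := jordan_linearized y e e y
  rw [he, mul_comm y e, hy] at h
  simpa only [mul_zero, zero_mul, add_zero, zero_add] using h.symm

theorem peirce_quadratic (he : e * e = e) (h₀ : ∀ y, e * y = 0 → y = 0) (x : A) :
    2 • (e * (e * x)) - 3 • (e * x) + x = 0 := by
  refine h₀ _ ?_
  rw [mul_add, mul_sub, mul_smul_comm, mul_smul_comm]
  exact peirce_identity he x

theorem peirce_half_mul_self_mul (he : e * e = e) (h₀ : ∀ y, e * y = 0 → y = 0) {w : A}
    (hw : 2 • (e * w) = w) : w * w * w = 0 := by
  have hew : 2 • (e * (e * w)) = e * w := by rw [← mul_smul_comm, hw]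
  have hwe : 2 • (w * (e * (e * w))) = w * (e * w) := by rw [← mul_smul_comm, hew]
  have hsq : 2 • (e * w * (e * w)) = w * (e * w) := by rw [← smul_mul_assoc, hw]
  have hfix : e * (e * (w * w)) = e * (w * w) := by
    have h := jordan_linearized e w w e
    rw [he, mul_comm w e, mul_comm (e * w) e, mul_comm (w * w) e] at h
    refine sub_eq_zero.1 <| (smul_eq_zero_iff_right (two_ne_zero' ℕ)).1 ?_
    linear_combination (norm := module) (2 : ℤ) • h - (2 : ℤ) • hwe + (2 : ℤ) • hsq
  have hone : e * (w * w) = w * w := sub_eq_zero.1 <| h₀ _ <| by rw [mul_sub, hfix, sub_self]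
  have hcube : w * w * (e * w) = w * w * w := by
    have h := IsJordan.lmul_lmul_comm_lmul w e
    rwa [mul_comm w e, mul_comm (w * w) e, hone, mul_comm w (w * w)] at h
  have htwo : 2 • (w * w * (e * w)) = w * w * w := by rw [← mul_smul_comm, hw]
  linear_combination (norm := module) htwo - (2 : ℤ) • hcube

end Peirce

end JordanIdentities

section Basic

variable {A : Type*} [JBStarAlgebra A]

instance : NormedStarGroup A := ⟨fun x => (JBStarAlgebra.norm_jstar x).le⟩

instance : IsAddTorsionFree A :=
  letI : Module ℚ A := Module.compHom A (algebraMap ℚ ℂ)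
  .of_module_rat A

theorem isSelfAdjoint_jmul {x y : A} (hx : IsSelfAdjoint x) (hy : IsSelfAdjoint y) :
    IsSelfAdjoint (x * y) := by
  rw [IsSelfAdjoint, star_mul', hx.star_eq, hy.star_eq]

theorem isSelfAdjoint_real_smul {x : A} (r : ℝ) (hx : IsSelfAdjoint x) : IsSelfAdjoint (r • x) :=
  (IsSelfAdjoint.all r).smul hx

/-- The Jordan product as a continuous bilinear map; `jordanMul a` is the operator usually
denoted `L_a`. -/
noncomputable def jordanMul : A →L[ℂ] A →L[ℂ] A :=
  LinearMap.mkContinuous₂ (LinearMap.mul ℂ A) 1 fun x y => by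
    simpa using JBStarAlgebra.norm_jmul_le x y

@[simp]
theorem jordanMul_apply (x y : A) : jordanMul x y = x * y := rfl

theorem norm_jordanMul_le (a : A) : ‖jordanMul a‖ ≤ ‖a‖ :=
  (jordanMul a).opNorm_le_bound (norm_nonneg a) (JBStarAlgebra.norm_jmul_le a)

instance : ContinuousMul A := ⟨(jordanMul (A := A)).continuous₂⟩

theorem isSelfAdjoint_jpow {a : A} (ha : IsSelfAdjoint a) (n : ℕ) : IsSelfAdjoint (jpow a n) := by
  induction n with
  | zero => exact ha
  | succ n ih => exact isSelfAdjoint_jmul ha ih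

/-- `e` is the unit of the algebra. A JB*-algebra need not have one. -/
structure IsJordanUnit (e : A) : Prop where
  left : ∀ x, e * x = x

namespace IsJordanUnit

variable {e : A} (he : IsJordanUnit e)
include he

theorem right (x : A) : x * e = x := by rw [mul_comm, he.left]

theorem isSelfAdjoint : IsSelfAdjoint e := by
  rw [IsSelfAdjoint, ← he.right (star e), ← star_star (star e * e), star_mul', star_star,
    he.left, star_star]

theorem norm_le_one : ‖e‖ ≤ 1 := by
  have h := JBStarAlgebra.norm_triple e
  rw [he.isSelfAdjoint.star_eq, he.left, he.left, add_sub_cancel_right] at h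
  by_contra! h1
  exact (lt_self_pow₀ h1 (by norm_num)).ne h

theorem norm_real_smul_le {r : ℝ} (hr : 0 ≤ r) : ‖r • e‖ ≤ r := by
  rw [norm_smul, Real.norm_of_nonneg hr]
  exact mul_le_of_le_one_right hr he.norm_le_one

end IsJordanUnit

end Basic

section ClosedAssocSub

variable {A : Type*} [JBStarAlgebra A]

/-- A closed associative Jordan *-subalgebra, which is a commutative C⋆-algebra in its own right:
the functional calculus and the order theory of C⋆-algebras reach a JB*-algebra through these. -/
structure ClosedAssocSub (A : Type*) [JBStarAlgebra A] extends NonUnitalStarSubalgebra ℂ A where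
  assoc : ∀ {x y z}, x ∈ carrier → y ∈ carrier → z ∈ carrier → x * y * z = x * (y * z)
  isClosed : IsClosed carrier

namespace ClosedAssocSub

/-- The underlying subspace. -/
abbrev toSub (S : ClosedAssocSub A) : Submodule ℂ A :=
  S.toNonUnitalStarSubalgebra.toNonUnitalSubalgebra.toSubmodule

/-- The C⋆-algebra underlying a closed associative subalgebra. -/
abbrev Elem (S : ClosedAssocSub A) : Type _ := S.toSub

theorem norm_sq_le_norm_star_mul (S : ClosedAssocSub A) {x : A} (hx : x ∈ S.toSub) :
    ‖x‖ * ‖x‖ ≤ ‖star x * x‖ := by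
  have htriple : x * star x * x + star x * x * x - x * x * star x = star x * x * x := by
    rw [mul_comm (x * x), ← S.assoc (S.star_mem' hx) hx hx, mul_comm x (star x),
      add_sub_cancel_right]
  have hcube : ‖x‖ ^ 3 ≤ ‖star x * x‖ * ‖x‖ := by
    rw [← JBStarAlgebra.norm_triple x, htriple]
    exact JBStarAlgebra.norm_jmul_le _ _
  rcases (norm_nonneg x).eq_or_lt with h0 | h0
  · rw [← h0, mul_zero]
    exact norm_nonneg _
  · exact le_of_mul_le_mul_right (by linarith) h0

noncomputable instance (S : ClosedAssocSub A) : NonUnitalCommCStarAlgebra S.Elem where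
  mul x y := ⟨x * y, S.mul_mem' x.2 y.2⟩
  left_distrib x y z := Subtype.ext (mul_add (x : A) y z)
  right_distrib x y z := Subtype.ext (add_mul (x : A) y z)
  zero_mul x := Subtype.ext (zero_mul (x : A))
  mul_zero x := Subtype.ext (mul_zero (x : A))
  mul_assoc x y z := Subtype.ext (S.assoc x.2 y.2 z.2)
  mul_comm x y := Subtype.ext (mul_comm (x : A) y)
  star x := ⟨star (x : A), S.star_mem' x.2⟩
  star_involutive x := Subtype.ext (star_star (x : A))
  star_mul x y := Subtype.ext (star_mul (x : A) y)
  star_add x y := Subtype.ext (star_add (x : A) y)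
  complete := (S.isClosed.completeSpace_coe : CompleteSpace S.toSub).complete
  norm_mul_le x y := JBStarAlgebra.norm_jmul_le (x : A) y
  dist_eq x y := by rw [dist_comm, dist_eq_norm, sub_eq_neg_add]
  norm_mul_self_le x := S.norm_sq_le_norm_star_mul x.2
  __ := (inferInstance : NormedSpace ℂ S.toSub)
  smul_assoc c x y := Subtype.ext (smul_mul_assoc c (x : A) y)
  smul_comm c x y := Subtype.ext (mul_smul_comm c (x : A) (y : A)).symm
  star_smul c x := Subtype.ext (star_smul c (x : A))

/-- The algebra structure of a closed associative subalgebra that contains the unit of `A`. -/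
noncomputable abbrev normedCommRing (S : ClosedAssocSub A) {e : A} (he : IsJordanUnit e)
    (hS : e ∈ S.toSub) : NormedCommRing S.Elem where
  __ := (inferInstance : NonUnitalNormedCommRing S.Elem)
  one := ⟨e, hS⟩
  one_mul x := Subtype.ext (he.left x)
  mul_one x := Subtype.ext (he.right x)

/-- A closed associative subalgebra that contains the unit of `A`, as a unital C⋆-algebra. -/
noncomputable abbrev commCStarAlgebra (S : ClosedAssocSub A) {e : A} (he : IsJordanUnit e)
    (hS : e ∈ S.toSub) : CommCStarAlgebra S.Elem :=
  letI := S.normedCommRing he hS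
  { S.normedCommRing he hS, (inferInstance : NonUnitalCommCStarAlgebra S.Elem),
    Algebra.ofModule (R := ℂ) (A := S.Elem) (smul_mul_assoc (β := S.Elem))
      (mul_smul_comm (β := S.Elem)) with
    norm_smul_le := norm_smul_le }

section ClosedSpan

variable {G : Set A}

theorem star_mem_span (hstar : ∀ x ∈ G, IsSelfAdjoint x) {x : A} (hx : x ∈ Submodule.span ℂ G) :
    star x ∈ Submodule.span ℂ G := by
  induction hx using Submodule.span_induction with
  | mem x hx => exact (hstar x hx).star_eq.symm ▸ Submodule.subset_span hx
  | zero => exact (star_zero A).symm ▸ zero_mem _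
  | add x y _ _ hx hy => exact star_add x y ▸ add_mem hx hy
  | smul c x _ hx => exact star_smul c x ▸ Submodule.smul_mem _ _ hx

theorem mul_mem_span (hmul : ∀ x ∈ G, ∀ y ∈ G, x * y ∈ G) {x y : A}
    (hx : x ∈ Submodule.span ℂ G) (hy : y ∈ Submodule.span ℂ G) : x * y ∈ Submodule.span ℂ G := by
  induction hx, hy using Submodule.span_induction₂ with
  | mem_mem x y hx hy => exact Submodule.subset_span (hmul x hx y hy)
  | zero_left y => exact (zero_mul y).symm ▸ zero_mem _
  | zero_right x => exact (mul_zero x).symm ▸ zero_mem _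
  | add_left x y z _ _ _ hx hy => exact (add_mul x y z).symm ▸ add_mem hx hy
  | add_right x y z _ _ _ hx hy => exact (mul_add x y z).symm ▸ add_mem hx hy
  | smul_left c x y _ _ h => exact (smul_mul_assoc c x y).symm ▸ Submodule.smul_mem _ _ h
  | smul_right c x y _ _ h => exact (mul_smul_comm c x y).symm ▸ Submodule.smul_mem _ _ h

theorem mul_assoc_of_mem_closure_span
    (hassoc : ∀ x ∈ G, ∀ y ∈ G, ∀ z ∈ G, x * y * z = x * (y * z)) {x y z : A}
    (hx : x ∈ closure (Submodule.span ℂ G : Set A)) (hy : y ∈ closure (Submodule.span ℂ G : Set A))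
    (hz : z ∈ closure (Submodule.span ℂ G : Set A)) : x * y * z = x * (y * z) := by
  have assoc_left : ∀ y ∈ G, ∀ z ∈ G, x * y * z = x * (y * z) := fun y hy z hz =>
    ContinuousLinearMap.eqOn_closure_span (f := jordanMul.flip z ∘L jordanMul.flip y)
      (g := jordanMul.flip (y * z)) (fun x hx => hassoc x hx y hy z hz) hx
  have assoc_middle : ∀ z ∈ G, x * y * z = x * (y * z) := fun z hz =>
    ContinuousLinearMap.eqOn_closure_span (f := jordanMul.flip z ∘L jordanMul x)
      (g := jordanMul x ∘L jordanMul.flip z) (fun y hy => assoc_left y hy z hz) hy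
  exact ContinuousLinearMap.eqOn_closure_span (f := jordanMul (x * y))
    (g := jordanMul x ∘L jordanMul y) assoc_middle hz

/-- The closed subalgebra spanned by a multiplicatively closed associative set of selfadjoint
elements. -/
def closedSpan (G : Set A) (hmul : ∀ x ∈ G, ∀ y ∈ G, x * y ∈ G)
    (hstar : ∀ x ∈ G, IsSelfAdjoint x)
    (hassoc : ∀ x ∈ G, ∀ y ∈ G, ∀ z ∈ G, x * y * z = x * (y * z)) : ClosedAssocSub A where
  toSubmodule := (Submodule.span ℂ G).topologicalClosure
  mul_mem' hx hy := map_mem_closure₂ continuous_mul hx hy fun _ ha _ hb => mul_mem_span hmul ha hb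
  star_mem' hx := map_mem_closure continuous_star hx fun _ ha => star_mem_span hstar ha
  assoc := mul_assoc_of_mem_closure_span hassoc
  isClosed := (Submodule.span ℂ G).isClosed_topologicalClosure

theorem mem_closedSpan {hmul hstar hassoc} {x : A} (hx : x ∈ G) :
    x ∈ (closedSpan G hmul hstar hassoc).toSub :=
  subset_closure (Submodule.subset_span hx)

end ClosedSpan

theorem exists_mem {a : A} (ha : IsSelfAdjoint a) : ∃ S : ClosedAssocSub A, a ∈ S.toSub := by
  refine ⟨closedSpan (Set.range (jpow a)) ?_ ?_ ?_, mem_closedSpan ⟨0, rfl⟩⟩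
  · rintro _ ⟨m, rfl⟩ _ ⟨n, rfl⟩
    exact ⟨_, (jpow_mul_jpow a m n).symm⟩
  · rintro _ ⟨m, rfl⟩
    exact isSelfAdjoint_jpow ha m
  · rintro _ ⟨m, rfl⟩ _ ⟨n, rfl⟩ _ ⟨k, rfl⟩
    simp only [jpow_mul_jpow]
    congr 1
    ring

theorem exists_mem_of_unit {e a : A} (he : IsJordanUnit e) (ha : IsSelfAdjoint a) :
    ∃ S : ClosedAssocSub A, e ∈ S.toSub ∧ a ∈ S.toSub := by
  refine ⟨closedSpan (insert e (Set.range (jpow a))) ?_ ?_ ?_,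
    mem_closedSpan (Set.mem_insert _ _),
    mem_closedSpan (Set.mem_insert_of_mem _ ⟨0, rfl⟩)⟩
  · rintro _ (rfl | ⟨m, rfl⟩) y hy
    · rwa [he.left]
    · obtain rfl | ⟨n, rfl⟩ := hy
      · exact .inr ⟨m, (he.right _).symm⟩
      · exact .inr ⟨_, (jpow_mul_jpow a m n).symm⟩
  · rintro _ (rfl | ⟨m, rfl⟩)
    · exact he.isSelfAdjoint
    · exact isSelfAdjoint_jpow ha m
  · rintro _ (rfl | ⟨m, rfl⟩) _ (rfl | ⟨n, rfl⟩) _ (rfl | ⟨k, rfl⟩)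
    all_goals simp only [he.left, he.right, jpow_mul_jpow]
    congr 1
    ring

end ClosedAssocSub

theorem norm_jmul_self {a : A} (ha : IsSelfAdjoint a) : ‖a * a‖ = ‖a‖ ^ 2 := by
  obtain ⟨S, haS⟩ := ClosedAssocSub.exists_mem ha
  have ha' : IsSelfAdjoint (⟨a, haS⟩ : S.Elem) := Subtype.ext ha
  exact ha'.norm_mul_self

end ClosedAssocSub

section CStarOrder

attribute [local instance] CStarAlgebra.spectralOrder CStarAlgebra.spectralOrderedRing

theorem cstar_nonneg_iff_norm_sub_le {C : Type*} [CStarAlgebra C] {x : C} (hx : IsSelfAdjoint x)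
    {r : ℝ} (hr : ‖x‖ ≤ r) : 0 ≤ x ↔ ‖algebraMap ℝ C r - x‖ ≤ r := by
  lift r to NNReal using (norm_nonneg x).trans hr
  exact (nonneg_iff_isSelfAdjoint_and_quasispectrumRestricts.trans
    (and_iff_right hx)).trans (SpectrumRestricts.nnreal_iff_nnnorm hx hr)

theorem cstar_norm_le_of_neg_le_of_le {C : Type*} [CStarAlgebra C] {x : C} (hx : IsSelfAdjoint x)
    {r : ℝ} (hr : 0 ≤ r) (hlower : 0 ≤ algebraMap ℝ C r + x) (hupper : 0 ≤ algebraMap ℝ C r - x) :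
    ‖x‖ ≤ r := by
  cases subsingleton_or_nontrivial C
  · rwa [Subsingleton.elim x 0, norm_zero]
  have hlower' : algebraMap ℝ C (-r) ≤ x := by rwa [map_neg, neg_le_iff_add_nonneg']
  rcases CStarAlgebra.norm_or_neg_norm_mem_spectrum hx with h | h
  · exact (le_algebraMap_iff_spectrum_le).1 (sub_nonneg.1 hupper) _ h
  · exact neg_le_neg_iff.1 ((algebraMap_le_iff_le_spectrum).1 hlower' _ h)

theorem cstar_exists_nonneg_le_mul_self {C : Type*} [NonUnitalCStarAlgebra C] {u : C}
    (hu : IsSelfAdjoint u) : ∃ p : C, 0 ≤ p ∧ u ≤ p * p ∧ ‖p‖ ^ 2 = ‖u‖ := by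
  refine ⟨CFC.sqrt (CFC.abs u), CFC.sqrt_nonneg _, ?_, ?_⟩
  · rw [CFC.sqrt_mul_sqrt_self _, ← sub_nonneg, CFC.abs_sub_self u]
    exact nsmul_nonneg (CFC.negPart_nonneg u) 2
  · rw [CFC.norm_sqrt _ (CFC.abs_nonneg u), CFC.norm_abs, Real.sq_sqrt (norm_nonneg u)]

end CStarOrder

section Order

variable {A : Type*} [JBStarAlgebra A]

/-- Positive elements: the squares of the selfadjoint elements. -/
def IsJordanPos (a : A) : Prop := ∃ s : A, IsSelfAdjoint s ∧ s * s = a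

theorem isJordanPos_mul_self {s : A} (hs : IsSelfAdjoint s) : IsJordanPos (s * s) := ⟨s, hs, rfl⟩

theorem IsJordanUnit.isJordanPos {e : A} (he : IsJordanUnit e) : IsJordanPos e :=
  ⟨e, he.isSelfAdjoint, he.left e⟩

section Transfer

attribute [local instance] CStarAlgebra.spectralOrder CStarAlgebra.spectralOrderedRing

theorem ClosedAssocSub.isJordanPos_of_nonneg {S : ClosedAssocSub A} {x : S.Elem} (hx : 0 ≤ x) :
    IsJordanPos (x : A) := by
  obtain ⟨s, hs, rfl⟩ := CStarAlgebra.nonneg_iff_exists_isSelfAdjoint_and_eq_mul_self.1 hx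
  exact ⟨s, congrArg Subtype.val hs, rfl⟩

theorem ClosedAssocSub.nonneg_mul_self {S : ClosedAssocSub A} {s : A} (hs : IsSelfAdjoint s)
    (hS : s ∈ S.toSub) : 0 ≤ (⟨s, hS⟩ * ⟨s, hS⟩ : S.Elem) :=
  IsSelfAdjoint.mul_self_nonneg (Subtype.ext hs)

theorem exists_isJordanPos_mul_self_sub {u : A} (hu : IsSelfAdjoint u) :
    ∃ p : A, IsJordanPos p ∧ IsJordanPos (p * p - u) ∧ ‖p‖ ^ 2 = ‖u‖ := by
  obtain ⟨S, huS⟩ := ClosedAssocSub.exists_mem hu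
  obtain ⟨p, hp, hpu, hnorm⟩ :=
    cstar_exists_nonneg_le_mul_self (show IsSelfAdjoint (⟨u, huS⟩ : S.Elem) from Subtype.ext hu)
  exact ⟨p, S.isJordanPos_of_nonneg hp, S.isJordanPos_of_nonneg (sub_nonneg.2 hpu), hnorm⟩

variable {a : A}

theorem IsJordanPos.isSelfAdjoint (h : IsJordanPos a) : IsSelfAdjoint a := by
  obtain ⟨s, hs, rfl⟩ := h
  exact isSelfAdjoint_jmul hs hs

theorem IsJordanPos.norm_smul_sub_mul_self (ha : IsJordanPos a) :
    IsJordanPos (‖a‖ • a - a * a) := by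
  obtain ⟨s, hs, rfl⟩ := ha
  obtain ⟨S, hsS⟩ := ClosedAssocSub.exists_mem hs
  set s' : S.Elem := ⟨s, hsS⟩
  have hs' : star s' = s' := Subtype.ext hs
  have h := CStarAlgebra.star_left_conjugate_le_norm_smul (a := s')
    (IsSelfAdjoint.of_nonneg (S.nonneg_mul_self hs hsS))
  rw [hs', mul_assoc s', mul_assoc s', ← mul_assoc s', ← sub_nonneg] at h
  exact S.isJordanPos_of_nonneg h

variable {e : A} (he : IsJordanUnit e)
include he

theorem isJordanPos_iff_norm_sub_le (ha : IsSelfAdjoint a) {r : ℝ} (hr : ‖a‖ ≤ r) :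
    IsJordanPos a ↔ ‖r • e - a‖ ≤ r := by
  constructor
  · rintro ⟨s, hs, rfl⟩
    obtain ⟨S, heS, hsS⟩ := ClosedAssocSub.exists_mem_of_unit he hs
    let _ := S.commCStarAlgebra he heS
    have hss : IsSelfAdjoint (⟨s, hsS⟩ * ⟨s, hsS⟩ : S.Elem) := Subtype.ext ha
    exact (cstar_nonneg_iff_norm_sub_le hss hr).1 (S.nonneg_mul_self hs hsS)
  · intro h
    obtain ⟨S, heS, haS⟩ := ClosedAssocSub.exists_mem_of_unit he ha
    let _ := S.commCStarAlgebra he heS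
    have ha' : IsSelfAdjoint (⟨a, haS⟩ : S.Elem) := Subtype.ext ha
    exact S.isJordanPos_of_nonneg ((cstar_nonneg_iff_norm_sub_le ha' hr).2 h)

theorem ClosedAssocSub.nonneg_of_isJordanPos {S : ClosedAssocSub A} (heS : e ∈ S.toSub)
    {x : S.Elem} (hx : IsJordanPos (x : A)) : 0 ≤ x := by
  let _ := S.commCStarAlgebra he heS
  have hx' : IsSelfAdjoint x := Subtype.ext hx.isSelfAdjoint
  exact (cstar_nonneg_iff_norm_sub_le hx' le_rfl).2
    ((isJordanPos_iff_norm_sub_le he hx.isSelfAdjoint le_rfl).1 hx)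

theorem norm_le_of_isJordanPos (ha : IsSelfAdjoint a) {r : ℝ} (hr : 0 ≤ r)
    (hlower : IsJordanPos (r • e + a)) (hupper : IsJordanPos (r • e - a)) : ‖a‖ ≤ r := by
  obtain ⟨S, heS, haS⟩ := ClosedAssocSub.exists_mem_of_unit he ha
  let _ := S.commCStarAlgebra he heS
  have ha' : IsSelfAdjoint (⟨a, haS⟩ : S.Elem) := Subtype.ext ha
  exact cstar_norm_le_of_neg_le_of_le ha' hr
    (S.nonneg_of_isJordanPos he heS hlower) (S.nonneg_of_isJordanPos he heS hupper)

theorem isJordanPos_smul_sub_of_norm_le (ha : IsSelfAdjoint a) {r : ℝ} (h : ‖a‖ ≤ r) :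
    IsJordanPos (r • e - a) := by
  obtain ⟨S, heS, haS⟩ := ClosedAssocSub.exists_mem_of_unit he ha
  let _ := S.commCStarAlgebra he heS
  have ha' : IsSelfAdjoint (⟨a, haS⟩ : S.Elem) := Subtype.ext ha
  exact S.isJordanPos_of_nonneg
    (sub_nonneg.2 (ha'.le_algebraMap_norm_self.trans (algebraMap_mono S.Elem h)))

theorem isJordanPos_smul_add_of_norm_le (ha : IsSelfAdjoint a) {r : ℝ} (h : ‖a‖ ≤ r) :
    IsJordanPos (r • e + a) := by
  rw [← sub_neg_eq_add]
  exact isJordanPos_smul_sub_of_norm_le he ha.neg (by rwa [norm_neg])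

end Transfer

namespace IsJordanPos

variable {a b e : A}

theorem norm_sub_le (he : IsJordanUnit e) (ha : IsJordanPos a) : ‖‖a‖ • e - a‖ ≤ ‖a‖ :=
  (isJordanPos_iff_norm_sub_le he ha.isSelfAdjoint le_rfl).1 ha

theorem add (he : IsJordanUnit e) (ha : IsJordanPos a) (hb : IsJordanPos b) :
    IsJordanPos (a + b) := by
  refine (isJordanPos_iff_norm_sub_le he (ha.isSelfAdjoint.add hb.isSelfAdjoint)
    (norm_add_le a b)).2 ?_
  rw [add_smul, add_sub_add_comm]
  exact (norm_add_le _ _).trans (add_le_add (ha.norm_sub_le he) (hb.norm_sub_le he))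

theorem smul (ha : IsJordanPos a) {r : ℝ} (hr : 0 ≤ r) : IsJordanPos (r • a) := by
  obtain ⟨s, hs, rfl⟩ := ha
  refine ⟨√r • s, isSelfAdjoint_real_smul _ hs, ?_⟩
  rw [smul_mul_smul_comm, Real.mul_self_sqrt hr]

protected theorem zero : IsJordanPos (0 : A) := ⟨0, .zero _, mul_zero _⟩

end IsJordanPos

theorem isClosed_setOf_isJordanPos {e : A} (he : IsJordanUnit e) :
    IsClosed {a : A | IsJordanPos a} := by
  have h : {a : A | IsJordanPos a} = {a | star a = a} ∩ {a | ‖‖a‖ • e - a‖ ≤ ‖a‖} := by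
    ext a
    exact ⟨fun h => ⟨h.isSelfAdjoint, h.norm_sub_le he⟩,
      fun h => (isJordanPos_iff_norm_sub_le he h.1 le_rfl).2 h.2⟩
  rw [h]
  exact (isClosed_eq continuous_star continuous_id).inter (isClosed_le (by fun_prop) (by fun_prop))

end Order

section UnitalContraction

variable {A B : Type*} {e : A} {e' : B} [JBStarAlgebra A] [JBStarAlgebra B]

/-- A unital contraction between unital JB*-algebras. For `B = ℂ` these are the states of `A`. -/
structure IsUnitalContraction (e : A) (e' : B) (T : A →ₗ[ℂ] B) : Prop where
  contractive : ∀ x, ‖T x‖ ≤ ‖x‖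
  map_unit : T e = e'

theorem star_mul_self_add_I_smul (he : IsJordanUnit e) {a : A} (ha : IsSelfAdjoint a) (r : ℝ) :
    star (a + Complex.I • r • e) * (a + Complex.I • r • e) = a * a + r ^ 2 • e := by
  have hstar : star (a + Complex.I • r • e) = a - Complex.I • r • e := by
    rw [star_add, star_smul, star_smul, ha.star_eq, he.isSelfAdjoint.star_eq, Complex.star_def,
      Complex.conj_I, star_trivial, neg_smul, sub_eq_add_neg]
  have hI : Complex.I • r • Complex.I • r • e = -(r ^ 2 • e) := by
    rw [smul_comm r, smul_smul, Complex.I_mul_I, smul_smul, neg_one_smul, sq]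
  simp only [hstar, sub_mul, mul_add, mul_smul_comm, smul_mul_assoc, smul_sub, he.left, he.right,
    hI]
  abel

theorem norm_add_I_smul_sq_le (he : IsJordanUnit e) {a : A} (ha : IsSelfAdjoint a) (r : ℝ) :
    ‖a + Complex.I • r • e‖ ^ 2 ≤ ‖a‖ ^ 2 + r ^ 2 := by
  obtain ⟨S, heS, haS⟩ := ClosedAssocSub.exists_mem_of_unit he ha
  have hmem : a + Complex.I • r • e ∈ S.toSub :=
    add_mem haS (S.toSub.smul_mem _ (S.toSub.smul_of_tower_mem r heS))
  calc ‖a + Complex.I • r • e‖ ^ 2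
      ≤ ‖star (a + Complex.I • r • e) * (a + Complex.I • r • e)‖ := by
        rw [sq]; exact S.norm_sq_le_norm_star_mul hmem
    _ = ‖a * a + r ^ 2 • e‖ := by rw [star_mul_self_add_I_smul he ha]
    _ ≤ ‖a‖ ^ 2 + r ^ 2 := by
        rw [← norm_jmul_self ha]
        exact (norm_add_le _ _).trans (add_le_add_right (he.norm_real_smul_le (sq_nonneg r)) _)

theorem norm_le_sub_of_norm_add_smul_le (he : IsJordanUnit e) {v : A} (hv : IsSelfAdjoint v)
    {r R : ℝ} (hr : r ≤ R) (hadd : ‖v + r • e‖ ≤ R) (hsub : ‖v - r • e‖ ≤ R) : ‖v‖ ≤ R - r := by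
  have hre := isSelfAdjoint_real_smul r he.isSelfAdjoint
  refine norm_le_of_isJordanPos he hv (sub_nonneg.2 hr) ?_ ?_
  · convert isJordanPos_smul_add_of_norm_le he (hv.sub hre) hsub using 1
    module
  · convert isJordanPos_smul_sub_of_norm_le he (hv.add hre) hadd using 1
    module

theorem eq_zero_of_norm_add_smul_sq_le (he : IsJordanUnit e) {v : A} (hv : IsSelfAdjoint v) {C : ℝ}
    (h : ∀ r : ℝ, ‖v + r • e‖ ^ 2 ≤ C + r ^ 2) : v = 0 := by
  have hC : 0 ≤ C := by simpa using (sq_nonneg _).trans (h 0)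
  have hbound : ∀ r : ℝ, 0 ≤ r → ‖v‖ * r ≤ C := by
    intro r hr
    have hsq := Real.sq_sqrt (add_nonneg hC (sq_nonneg r))
    have hle : r ≤ √(C + r ^ 2) := Real.le_sqrt_of_sq_le (le_add_of_nonneg_left hC)
    have hv' := norm_le_sub_of_norm_add_smul_le he hv hle (Real.le_sqrt_of_sq_le (h r))
      (Real.le_sqrt_of_sq_le (by simpa [sub_eq_add_neg] using h (-r)))
    nlinarith [norm_nonneg v]
  by_contra h0
  have hpos := norm_pos_iff.2 h0
  have := hbound ((C + 1) / ‖v‖) (by positivity)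
  rw [mul_div_cancel₀ _ hpos.ne'] at this
  linarith

namespace IsUnitalContraction

variable {T : A →ₗ[ℂ] B} (hT : IsUnitalContraction e e' T) (he : IsJordanUnit e)
  (he' : IsJordanUnit e')
include hT he he'

theorem isSelfAdjoint_map {a : A} (ha : IsSelfAdjoint a) : IsSelfAdjoint (T a) := by
  refine imaginaryPart_eq_zero_iff.1 <| Subtype.ext <|
    eq_zero_of_norm_add_smul_sq_le he' (ℑ (T a)).2 (C := ‖a‖ ^ 2) fun r => ?_
  have him : (ℑ (T (a + Complex.I • r • e)) : B) = ℑ (T a) + r • e' := by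
    rw [map_add, map_smul, T.map_smul_of_tower, hT.map_unit, map_add, imaginaryPart_I_smul,
      AddSubgroup.coe_add, (isSelfAdjoint_real_smul r he'.isSelfAdjoint).coe_realPart]
  calc ‖(ℑ (T a) : B) + r • e'‖ ^ 2 = ‖ℑ (T (a + Complex.I • r • e))‖ ^ 2 := by rw [← him]; rfl
    _ ≤ ‖a + Complex.I • r • e‖ ^ 2 := by
        gcongr; exact (imaginaryPart.norm_le _).trans (hT.contractive _)
    _ ≤ ‖a‖ ^ 2 + r ^ 2 := norm_add_I_smul_sq_le he ha r

theorem isJordanPos_map {a : A} (ha : IsJordanPos a) : IsJordanPos (T a) := by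
  refine (isJordanPos_iff_norm_sub_le he' (hT.isSelfAdjoint_map he he' ha.isSelfAdjoint)
    (hT.contractive a)).2 ?_
  rw [← hT.map_unit, ← T.map_smul_of_tower, ← map_sub]
  exact (hT.contractive _).trans (ha.norm_sub_le he)

end IsUnitalContraction

end UnitalContraction

section State

/-- The complex numbers as a JB*-algebra, so that states are unital contractions. It is only a local
instance because it would compete with Mathlib's path to the ring structure of `ℂ`. -/
noncomputable abbrev complexJBStarAlgebra : JBStarAlgebra ℂ where
  lmul_comm_rmul_rmul := IsCommJordan.lmul_comm_rmul_rmul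
  norm_smul_le := norm_smul_le
  norm_jmul_le := norm_mul_le
  norm_jstar := norm_star
  star_mul := star_mul
  star_add := star_add
  norm_triple x := by
    rw [show x * star x * x + star x * x * x - x * x * star x = x * x * star x by ring]
    simp only [norm_mul, norm_star]
    ring

attribute [local instance] complexJBStarAlgebra

theorem isJordanUnit_one_complex : IsJordanUnit (1 : ℂ) := ⟨one_mul⟩

theorem IsJordanPos.complex_re_nonneg {z : ℂ} (hz : IsJordanPos z) : 0 ≤ z.re := by
  obtain ⟨s, hs, rfl⟩ := hz
  rw [Complex.mul_re, Complex.conj_eq_iff_im.1 hs, mul_zero, sub_zero]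
  exact mul_self_nonneg _

variable {A : Type*} [JBStarAlgebra A] {e : A} {ρ : A →ₗ[ℂ] ℂ}

namespace IsUnitalContraction

variable (hρ : IsUnitalContraction e (1 : ℂ) ρ) (he : IsJordanUnit e)
include hρ he

theorem im_eq_zero {a : A} (ha : IsSelfAdjoint a) : (ρ a).im = 0 :=
  Complex.conj_eq_iff_im.1 (hρ.isSelfAdjoint_map he isJordanUnit_one_complex ha)

theorem re_nonneg {a : A} (ha : IsJordanPos a) : 0 ≤ (ρ a).re :=
  (hρ.isJordanPos_map he isJordanUnit_one_complex ha).complex_re_nonneg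

theorem mul_eq_zero_of_mul_self {a y : A} (ha : IsSelfAdjoint a) (hy : IsSelfAdjoint y)
    (h : (ρ (y * y)).re = 0) : ρ (a * y) = 0 := by
  refine Complex.ext ?_ (hρ.im_eq_zero he (isSelfAdjoint_jmul ha hy))
  have hnonneg : ∀ t : ℝ, 0 ≤ (ρ (a * a)).re + t * (2 * (ρ (a * y)).re) := by
    intro t
    have hsq : (a + t • y) * (a + t • y) = a * a + (2 * t) • (a * y) + t ^ 2 • (y * y) := by
      simp only [add_mul, mul_add, mul_smul_comm, smul_mul_assoc, mul_comm y a]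
      module
    have hpos := hρ.re_nonneg he
      (isJordanPos_mul_self (ha.add (isSelfAdjoint_real_smul t hy)))
    simp only [hsq, map_add, ρ.map_smul_of_tower, Complex.add_re, Complex.smul_re, smul_eq_mul, h]
      at hpos
    linarith
  by_contra h0
  have h0' : 2 * (ρ (a * y)).re ≠ 0 := mul_ne_zero two_ne_zero h0
  have := hnonneg (-((ρ (a * a)).re + 1) / (2 * (ρ (a * y)).re))
  rw [div_mul_cancel₀ _ h0'] at this
  linarith

theorem mul_eq_zero_of_isJordanPos {a y : A} (ha : IsSelfAdjoint a) (hy : IsJordanPos y)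
    (h : ρ y = 0) : ρ (a * y) = 0 := by
  refine hρ.mul_eq_zero_of_mul_self he ha hy.isSelfAdjoint (le_antisymm ?_ ?_)
  · simpa [ρ.map_smul_of_tower, h] using hρ.re_nonneg he hy.norm_smul_sub_mul_self
  · exact hρ.re_nonneg he (isJordanPos_mul_self hy.isSelfAdjoint)

end IsUnitalContraction

theorem IsJordanPos.one_add_norm_le_norm_unit_add (he : IsJordanUnit e) (he0 : e ≠ 0) {z : A}
    (hz : IsJordanPos z) : 1 + ‖z‖ ≤ ‖e + z‖ := by
  have hsub : IsJordanPos ((‖e + z‖ - 1) • e - z) := by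
    convert isJordanPos_smul_sub_of_norm_le he (he.isSelfAdjoint.add hz.isSelfAdjoint) le_rfl
      using 1
    module
  have hpos : IsJordanPos ((‖e + z‖ - 1) • e) := by simpa only [sub_add_cancel] using hsub.add he hz
  have hnonneg : 0 ≤ ‖e + z‖ - 1 := by
    by_contra! hneg
    have h := hpos.norm_sub_le he
    rw [← sub_smul, norm_smul, norm_smul, Real.norm_of_nonpos hneg.le] at h
    have := le_of_mul_le_mul_right h (norm_pos_iff.2 he0)
    have he1 := mul_pos (neg_pos.2 hneg) (norm_pos_iff.2 he0)
    rw [Real.norm_of_nonneg (by linarith)] at this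
    linarith
  linarith [norm_le_of_isJordanPos he hz.isSelfAdjoint hnonneg (hpos.add he hz) hsub]

theorem exists_state_eq_norm (he : IsJordanUnit e) (he0 : e ≠ 0) {z : A} (hz : IsJordanPos z) :
    ∃ ρ : A →ₗ[ℂ] ℂ, IsUnitalContraction e (1 : ℂ) ρ ∧ ρ z = ‖z‖ := by
  obtain ⟨g, hg, hgez⟩ := exists_dual_vector'' ℂ (e + z)
  have hcontr : ∀ x, ‖g x‖ ≤ ‖x‖ := fun x => (g.le_of_opNorm_le hg x).trans_eq (one_mul _)
  have hge : ‖g e‖ ≤ 1 := (hcontr e).trans he.norm_le_one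
  have hsum : 1 + ‖z‖ ≤ (g e).re + (g z).re := by
    rw [← Complex.add_re, ← map_add, hgez]
    exact hz.one_add_norm_le_norm_unit_add he he0
  have hre_e := Complex.re_le_norm (g e)
  have hre_z := (Complex.re_le_norm (g z)).trans (hcontr z)
  have hge' : g e = 1 := by
    have hre : (g e).re = 1 := by linarith
    rw [← RCLike.re_eq_self_of_le (a := g e) (by simpa only [RCLike.re_to_complex, hre] using hge),
      RCLike.re_to_complex, hre, RCLike.ofReal_one]
  have hgz : g z = ‖z‖ := by
    have hre : (g z).re = ‖z‖ := by linarith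
    rw [← RCLike.re_eq_self_of_le (a := g z)
      (by simpa only [RCLike.re_to_complex, hre] using hcontr z), RCLike.re_to_complex, hre]
    rfl
  exact ⟨g.toLinearMap, ⟨hcontr, hge'⟩, hgz⟩

theorem exists_state_eq_lower_bound (he : IsJordanUnit e) (he0 : e ≠ 0) {y : A}
    (hy : IsSelfAdjoint y) :
    ∃ (m : ℝ) (ρ : A →ₗ[ℂ] ℂ), IsUnitalContraction e (1 : ℂ) ρ ∧ IsJordanPos (y - m • e) ∧
      ρ y = m := by
  have hz := isJordanPos_smul_sub_of_norm_le he hy le_rfl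
  obtain ⟨ρ, hρ, hρz⟩ := exists_state_eq_norm he he0 hz
  refine ⟨‖y‖ - ‖‖y‖ • e - y‖, ρ, hρ, ?_, ?_⟩
  · convert isJordanPos_smul_sub_of_norm_le he hz.isSelfAdjoint le_rfl using 1
    module
  · rw [Complex.ofReal_sub, ← hρz, map_sub, ρ.map_smul_of_tower, hρ.map_unit, Complex.real_smul,
      mul_one, sub_sub_cancel]

end State

section Exponential

section BanachAlgebra

theorem mul_inverse_one_sub_smul {R : Type*} [Ring R] [Algebra ℝ R] {a : R} {ε : ℝ} (hε : ε ≠ 0)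
    (h : IsUnit (1 - ε • a)) :
    a * Ring.inverse (1 - ε • a) = ε⁻¹ • Ring.inverse (1 - ε • a) - algebraMap ℝ R ε⁻¹ := by
  have hR := Ring.mul_inverse_cancel _ h
  rw [sub_mul, one_mul, smul_mul_assoc, sub_eq_iff_eq_add] at hR
  rw [Algebra.algebraMap_eq_smul_one, ← smul_sub, eq_comm, inv_smul_eq_iff₀ hε, sub_eq_iff_eq_add']
  exact hR

variable {R : Type*} [NormedRing R] [NormedAlgebra ℝ R] [CompleteSpace R]

theorem exp_add_of_commute_real {a b : R} (h : Commute a b) : exp (a + b) = exp a * exp b :=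
  let _ := NormedAlgebra.restrictScalars ℚ ℝ R
  NormedSpace.exp_add_of_commute h

theorem exp_neg_mul_exp (a : R) : exp (-a) * exp a = 1 := by
  rw [← exp_add_of_commute_real (Commute.refl a).neg_left, neg_add_cancel, NormedSpace.exp_zero]

theorem exp_sub_algebraMap (a : R) (c : ℝ) :
    exp (a - algebraMap ℝ R c) = Real.exp (-c) • exp a := by
  rw [sub_eq_add_neg, ← map_neg, exp_add_of_commute_real (Algebra.commute_algebraMap_right _ _),
    ← NormedSpace.algebraMap_exp_comm, ← Real.exp_eq_exp_ℝ, ← Algebra.commutes, Algebra.smul_def]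

theorem tendsto_exp_mul_inverse_one_sub_smul (a : R) :
    Filter.Tendsto (fun ε : ℝ => exp (a * Ring.inverse (1 - ε • a))) (𝓝[>] 0) (𝓝 (exp a)) := by
  let _ := NormedAlgebra.restrictScalars ℚ ℝ R
  have hinv : ContinuousAt (fun ε : ℝ => Ring.inverse (1 - ε • a)) 0 := by
    refine ContinuousAt.comp (g := Ring.inverse) (f := fun ε : ℝ => 1 - ε • a) ?_ (by fun_prop)
    simpa using NormedRing.inverse_continuousAt (1 : Rˣ)
  have hexp : ContinuousAt (fun ε : ℝ => exp (a * Ring.inverse (1 - ε • a))) 0 :=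
    (NormedSpace.exp_continuous (𝔸 := R)).continuousAt.comp (hinv.const_mul a)
  simpa using hexp.tendsto.mono_left nhdsWithin_le_nhds

end BanachAlgebra

variable {X : Type*} [NormedAddCommGroup X] [NormedSpace ℂ X] [CompleteSpace X] (T : X →L[ℂ] X)
  (x : X)

theorem hasSum_exp_apply : HasSum (fun n : ℕ => (n.factorial : ℂ)⁻¹ • (T ^ n) x) (exp T x) :=
  (NormedSpace.exp_series_hasSum_exp' (𝕂 := ℂ) T).mapL (ContinuousLinearMap.apply ℂ X x)

theorem hasDerivAt_exp_smul_apply (z : ℂ) :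
    HasDerivAt (fun z : ℂ => exp (z • T) x) (T (exp (z • T) x)) z := by
  simpa using (hasDerivAt_exp_smul_const' T z).clm_apply (hasDerivAt_const z x)

theorem exp_neg_apply_exp_apply : exp (-T) (exp T x) = x :=
  DFunLike.congr_fun (exp_neg_mul_exp T) x

variable {T x}

theorem map_exp_apply_eq_self {E : X →L[ℂ] X} (h : ∀ n, E ((T ^ n) x) = (T ^ n) x) :
    E (exp T x) = exp T x := by
  refine ((hasSum_exp_apply T x).mapL E).unique ?_
  simpa only [map_smul, h] using hasSum_exp_apply T x

/-- `exp (-z T) (W z)` is constant. -/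
theorem eq_exp_smul_apply_of_hasDerivAt {W : ℂ → X} (h : ∀ z, HasDerivAt W (T (W z)) z) (z : ℂ) :
    W z = exp (z • T) (W 0) := by
  have hderiv : ∀ z, HasDerivAt (fun z => exp (z • -T) (W z)) 0 z := fun z =>
    ((hasDerivAt_exp_smul_const (-T) z).clm_apply (h z)).congr_deriv (by simp)
  have hconst := is_const_of_deriv_eq_zero (fun z => (hderiv z).differentiableAt)
    (fun z => (hderiv z).deriv) z 0
  simp only [zero_smul, NormedSpace.exp_zero, one_apply_eq_self] at hconst
  rw [← hconst, smul_neg]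
  simpa using (exp_neg_apply_exp_apply (-(z • T)) (W z)).symm

theorem star_exp_apply [StarAddMonoid X] [StarModule ℂ X] [ContinuousStar X] {T' : X →L[ℂ] X}
    (h : ∀ x, star (T x) = T' (star x)) (x : X) : star (exp T x) = exp T' (star x) := by
  have hpow : ∀ (n : ℕ) (x : X), star ((T ^ n) x) = (T' ^ n) (star x) := by
    intro n
    induction n with
    | zero => exact fun _ => rfl
    | succ n ih => intro x; rw [pow_succ, pow_succ, mul_apply_eq_comp, mul_apply_eq_comp, ih, h]
  refine (hasSum_exp_apply T x).star.unique ?_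
  simpa only [star_smul, star_inv₀, star_natCast, hpow] using hasSum_exp_apply T' (star x)

end Exponential

section Multiplication

variable {A : Type*} [JBStarAlgebra A]

/-- The triple product `{x, y, x}`. -/
def jordanTriple (x y : A) : A := x * y * x + y * x * x - x * x * y

theorem norm_jordanTriple_star (x : A) : ‖jordanTriple x (star x)‖ = ‖x‖ ^ 3 :=
  JBStarAlgebra.norm_triple x

theorem hasDerivAt_jmul {x y : ℂ → A} {x' y' : A} {z : ℂ} (hx : HasDerivAt x x' z)
    (hy : HasDerivAt y y' z) : HasDerivAt (fun z => x z * y z) (x' * y z + x z * y') z :=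
  ((jordanMul (A := A)).hasFDerivAt.comp_hasDerivAt z hx).clm_apply hy

/-- By `mul_triple`, `L_a` is a derivation of the triple product for the action of `L_a` on the
outer variables and of `-L_a` on the inner one. -/
theorem jordanTriple_exp_smul (a x y : A) (z : ℂ) :
    jordanTriple (exp (z • jordanMul a) x) (exp (z • -jordanMul a) y) =
      exp (z • jordanMul a) (jordanTriple x y) := by
  have hx := hasDerivAt_exp_smul_apply (jordanMul a) x
  have hy := hasDerivAt_exp_smul_apply (-jordanMul a) y
  refine (eq_exp_smul_apply_of_hasDerivAt (T := jordanMul a)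
    (W := fun z => jordanTriple (exp (z • jordanMul a) x) (exp (z • -jordanMul a) y))
    (fun z => ?_) z).trans (by simp)
  refine (((hasDerivAt_jmul (hasDerivAt_jmul (hx z) (hy z)) (hx z)).add
    (hasDerivAt_jmul (hasDerivAt_jmul (hy z) (hx z)) (hx z))).sub
    (hasDerivAt_jmul (hasDerivAt_jmul (hx z) (hx z)) (hy z))).congr_deriv ?_
  simp only [jordanTriple, neg_apply, jordanMul_apply, mul_triple, mul_neg, neg_mul, add_mul]
  abel

/-- Iterating `‖{x, x*, x}‖ = ‖x‖ ^ 3` gives `‖T x‖ ^ 3 ^ n ≤ C * ‖x‖ ^ 3 ^ n` for all `n`. -/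
theorem norm_map_le_of_map_jordanTriple {B : Type*} [JBStarAlgebra B] {T : A → B} {C : ℝ}
    (hC : ∀ x, ‖T x‖ ≤ C * ‖x‖)
    (hT : ∀ x, T (jordanTriple x (star x)) = jordanTriple (T x) (star (T x))) (x : A) :
    ‖T x‖ ≤ ‖x‖ := by
  have hiter : ∀ (n : ℕ) (x : A), ‖T x‖ ^ 3 ^ n ≤ C * ‖x‖ ^ 3 ^ n := by
    intro n
    induction n with
    | zero => simpa using hC
    | succ n ih =>
      intro x
      simpa only [hT, norm_jordanTriple_star, ← pow_mul, ← pow_succ'] using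
        ih (jordanTriple x (star x))
  by_contra! hlt
  rcases (norm_nonneg x).eq_or_lt with h0 | h0
  · have := hC x
    rw [← h0, mul_zero] at this
    linarith
  have hq : 1 < ‖T x‖ / ‖x‖ := (one_lt_div h0).2 hlt
  obtain ⟨n, hn⟩ := pow_unbounded_of_one_lt C hq
  refine hn.not_ge ((pow_le_pow_right₀ hq.le (Nat.lt_pow_self (by norm_num : 1 < 3)).le).trans ?_)
  rw [div_pow, div_le_iff₀ (by positivity)]
  exact hiter n x

theorem norm_exp_I_smul_jordanMul_le {a : A} (ha : IsSelfAdjoint a) (s : ℝ) (x : A) :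
    ‖exp ((s * Complex.I) • jordanMul a) x‖ ≤ ‖x‖ := by
  refine norm_map_le_of_map_jordanTriple
    (ContinuousLinearMap.le_opNorm (exp ((s * Complex.I) • jordanMul a))) (fun x => ?_) x
  rw [star_exp_apply (T' := (s * Complex.I) • -jordanMul a)
    (fun x => by simp [star_smul, star_mul', ha.star_eq]), jordanTriple_exp_smul]

end Multiplication

section PositiveMap

variable {A B : Type*} {e : A} {e' : B} [JBStarAlgebra A] [JBStarAlgebra B]

/-- A map that maps positive elements to positive elements. -/
def IsPositiveMap (T : A → B) : Prop := ∀ ⦃x⦄, IsJordanPos x → IsJordanPos (T x)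

namespace IsPositiveMap

theorem mul {S T : A →L[ℂ] A} (hS : IsPositiveMap S) (hT : IsPositiveMap T) :
    IsPositiveMap ⇑(S * T) := fun _ hx => hS (hT hx)

theorem pow {T : A →L[ℂ] A} (hT : IsPositiveMap T) (n : ℕ) : IsPositiveMap ⇑(T ^ n) := by
  induction n with
  | zero => exact fun x hx => hx
  | succ n ih => rw [pow_succ]; exact ih.mul hT

theorem real_smul {T : A →L[ℂ] A} (hT : IsPositiveMap T) {r : ℝ} (hr : 0 ≤ r) :
    IsPositiveMap ⇑(r • T) := fun _ hx => (hT hx).smul hr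

protected theorem exp (he : IsJordanUnit e) {T : A →L[ℂ] A} (hT : IsPositiveMap T) :
    IsPositiveMap ⇑(exp T) := by
  intro x hx
  refine (isClosed_setOf_isJordanPos he).mem_of_tendsto (hasSum_exp_apply T x)
    (Filter.Eventually.of_forall fun s => ?_)
  refine Finset.sum_induction _ IsJordanPos (fun _ _ ha hb => ha.add he hb) .zero fun n _ => ?_
  have hpos := (hT.pow n hx).smul (r := (n.factorial : ℝ)⁻¹) (by positivity)
  rwa [← Complex.coe_smul, Complex.ofReal_inv, Complex.ofReal_natCast] at hpos

variable {T : A →ₗ[ℂ] B} (hT : IsPositiveMap T) (he : IsJordanUnit e) (he' : IsJordanUnit e')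
  (hTe : T e = e')
include hT he he' hTe

theorem norm_map_le_of_isSelfAdjoint {x : A} (hx : IsSelfAdjoint x) : ‖T x‖ ≤ ‖x‖ := by
  have hlower := hT (isJordanPos_smul_add_of_norm_le he hx le_rfl)
  have hupper := hT (isJordanPos_smul_sub_of_norm_le he hx le_rfl)
  rw [map_add, T.map_smul_of_tower, hTe] at hlower
  rw [map_sub, T.map_smul_of_tower, hTe] at hupper
  refine norm_le_of_isJordanPos he' ?_ (norm_nonneg x) hlower hupper
  simpa only [add_sub_cancel_left] using
    hlower.isSelfAdjoint.sub (isSelfAdjoint_real_smul ‖x‖ he'.isSelfAdjoint)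

theorem norm_map_le (x : A) : ‖T x‖ ≤ 2 * ‖x‖ := by
  have hre := (hT.norm_map_le_of_isSelfAdjoint he he' hTe (ℜ x).2).trans (realPart.norm_le x)
  have him := (hT.norm_map_le_of_isSelfAdjoint he he' hTe (ℑ x).2).trans (imaginaryPart.norm_le x)
  calc ‖T x‖ = ‖T (ℜ x) + Complex.I • T (ℑ x)‖ := by
        rw [← map_smul, ← map_add, realPart_add_I_smul_imaginaryPart]
    _ ≤ ‖T (ℜ x)‖ + ‖T (ℑ x)‖ :=
        (norm_add_le _ _).trans_eq (by rw [norm_smul, Complex.norm_I, one_mul])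
    _ ≤ 2 * ‖x‖ := by linarith

end IsPositiveMap

theorem isSelfAdjoint_of_isSelfAdjoint_sub_mul {a y : A} (ha : IsSelfAdjoint a) (ha1 : ‖a‖ < 1)
    (h : IsSelfAdjoint (y - a * y)) : IsSelfAdjoint y := by
  have hfix : star y - y = a * (star y - y) := by
    have hstar := h.star_eq
    rw [star_sub, star_mul', ha.star_eq] at hstar
    rw [mul_sub]
    linear_combination (norm := abel) hstar
  have hle := JBStarAlgebra.norm_jmul_le a (star y - y)
  rw [← hfix] at hle
  exact sub_eq_zero.1 (norm_eq_zero.1 (by nlinarith [norm_nonneg (star y - y)]))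

attribute [local instance] complexJBStarAlgebra in
/-- Take a state `ρ` at which `y` attains its lower bound `m`. Then `ρ (a * y) = m * ρ a`, hence
`ρ (y - a * y) = m * (1 - ρ a)`. -/
theorem isJordanPos_of_isJordanPos_sub_mul (he : IsJordanUnit e) {a y : A} (ha : IsSelfAdjoint a)
    (ha1 : ‖a‖ < 1) (h : IsJordanPos (y - a * y)) : IsJordanPos y := by
  have hy := isSelfAdjoint_of_isSelfAdjoint_sub_mul ha ha1 h.isSelfAdjoint
  rcases eq_or_ne e 0 with rfl | he0
  · rw [← he.left y, zero_mul]; exact .zero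
  obtain ⟨m, ρ, hρ, hpos, hm⟩ := exists_state_eq_lower_bound he he0 hy
  have hzero := hρ.mul_eq_zero_of_isJordanPos he ha hpos
    (by rw [map_sub, hm, ρ.map_smul_of_tower, hρ.map_unit]; simp)
  have hay : ρ (a * y) = m * ρ a := by
    rwa [mul_sub, mul_smul_comm, he.right, map_sub, ρ.map_smul_of_tower, sub_eq_zero,
      Complex.real_smul] at hzero
  have hre := hρ.re_nonneg he h
  rw [map_sub, hm, hay, Complex.sub_re, Complex.ofReal_re, Complex.re_ofReal_mul] at hre
  have ha' := (Complex.re_le_norm _).trans (hρ.contractive a)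
  have hm0 : 0 ≤ m := by
    by_contra! hneg
    nlinarith
  simpa only [sub_add_cancel] using hpos.add he (he.isJordanPos.smul hm0)

theorem isUnit_one_sub_jordanMul {a : A} (ha1 : ‖a‖ < 1) : IsUnit (1 - jordanMul a) :=
  isUnit_one_sub_of_norm_lt_one ((norm_jordanMul_le a).trans_lt ha1)

theorem isPositiveMap_inverse_one_sub_jordanMul (he : IsJordanUnit e) {a : A}
    (ha : IsSelfAdjoint a) (ha1 : ‖a‖ < 1) :
    IsPositiveMap ⇑(Ring.inverse (1 - jordanMul a)) := by
  intro x hx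
  refine isJordanPos_of_isJordanPos_sub_mul he ha ha1 ?_
  convert hx using 1
  exact DFunLike.congr_fun (Ring.mul_inverse_cancel _ (isUnit_one_sub_jordanMul ha1)) x

/-- Resolvent positivity passes to the exponential of the bounded operators
`L_a (1 - ε L_a)⁻¹ = ε⁻¹ (1 - ε L_a)⁻¹ - ε⁻¹`, which converge to `L_a`. -/
theorem isPositiveMap_exp_jordanMul (he : IsJordanUnit e) {a : A} (ha : IsSelfAdjoint a) :
    IsPositiveMap ⇑(exp (jordanMul a)) := by
  intro x hx
  have hlim := (ContinuousLinearMap.apply ℂ A x).continuous.tendsto _ |>.comp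
    (tendsto_exp_mul_inverse_one_sub_smul (jordanMul a))
  refine (isClosed_setOf_isJordanPos he).mem_of_tendsto hlim ?_
  have hsmall : ∀ᶠ ε in 𝓝[>] (0 : ℝ), ε * ‖a‖ < 1 :=
    ((continuous_mul_const ‖a‖).tendsto' 0 0 (zero_mul _)).mono_left nhdsWithin_le_nhds
      |>.eventually_lt_const one_pos
  filter_upwards [hsmall, self_mem_nhdsWithin] with ε hε hε0
  have hε0 : 0 < ε := hε0
  have hnorm : ‖ε • a‖ < 1 := by rwa [norm_smul, Real.norm_of_nonneg hε0.le]
  have hunit := isUnit_one_sub_jordanMul hnorm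
  have hpos := isPositiveMap_inverse_one_sub_jordanMul he (isSelfAdjoint_real_smul ε ha) hnorm
  rw [jordanMul.map_smul_of_tower] at hunit hpos
  have := ((hpos.real_smul (inv_nonneg.2 hε0.le)).exp he).real_smul (Real.exp_pos (-ε⁻¹)).le hx
  rwa [← exp_sub_algebraMap, ← mul_inverse_one_sub_smul hε0.ne' hunit] at this

end PositiveMap

section ContractiveProjection

section

variable {R : Type*} [NormedRing R] [NormedAlgebra ℂ R] [CompleteSpace R] (a : R) (z : ℂ)

theorem exp_smul_eq_exp_re_mul_exp_im :
    exp (z • a) = exp (z.re • a) * exp ((z.im * Complex.I) • a) := by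
  rw [← Complex.coe_smul, ← exp_add_of_commute_real (((Commute.refl a).smul_left _).smul_right _),
    ← add_smul, Complex.re_add_im]

theorem exp_smul_eq_exp_im_mul_exp_re :
    exp (z • a) = exp ((z.im * Complex.I) • a) * exp (z.re • a) := by
  rw [← Complex.coe_smul, ← exp_add_of_commute_real (((Commute.refl a).smul_left _).smul_right _),
    ← add_smul, add_comm, Complex.re_add_im]

end

variable {A : Type*} [JBStarAlgebra A] {e : A} (he : IsJordanUnit e)
  {N : NonUnitalStarSubalgebra ℂ A} (heN : e ∈ N) {E : A →L[ℂ] A} (hE : ∀ x, ‖E x‖ ≤ ‖x‖)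
  (hEN : ∀ x ∈ N, E x = x) {n : A} (hn : IsSelfAdjoint n) (hnN : n ∈ N)

include heN hEN hnN in
theorem map_exp_jordanMul_unit : E (exp (jordanMul n) e) = exp (jordanMul n) e := by
  refine map_exp_apply_eq_self fun k => hEN _ ?_
  induction k with
  | zero => exact heN
  | succ k ih => rw [pow_succ']; exact mul_mem hnN ih

include he heN hE hEN hn hnN

theorem norm_exp_neg_map_exp_le (x : A) :
    ‖exp (-jordanMul n) (E (exp (jordanMul n) x))‖ ≤ 2 * ‖x‖ := by
  have hEpos : IsPositiveMap E := fun _ hx =>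
    IsUnitalContraction.isJordanPos_map (T := E.toLinearMap) ⟨hE, hEN e heN⟩ he he hx
  have hneg := isPositiveMap_exp_jordanMul he hn.neg
  rw [map_neg] at hneg
  refine IsPositiveMap.norm_map_le (T := (exp (-jordanMul n) * E * exp (jordanMul n)).toLinearMap)
    ((hneg.mul hEpos).mul (isPositiveMap_exp_jordanMul he hn)) he he ?_ x
  rw [ContinuousLinearMap.coe_coe, mul_apply_eq_comp, mul_apply_eq_comp,
    map_exp_jordanMul_unit heN hEN hnN, exp_neg_apply_exp_apply]

theorem norm_exp_smul_neg_map_exp_smul_le (z : ℂ) (x : A) :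
    ‖exp (z • -jordanMul n) (E (exp (z • jordanMul n) x))‖ ≤ 2 * ‖x‖ := by
  have hre : ∀ y, ‖exp (z.re • -jordanMul n) (E (exp (z.re • jordanMul n) y))‖ ≤ 2 * ‖y‖ := by
    simpa only [jordanMul.map_smul_of_tower, smul_neg] using norm_exp_neg_map_exp_le he heN hE hEN
      (isSelfAdjoint_real_smul z.re hn) (N.smul_of_tower_mem z.re hnN)
  rw [exp_smul_eq_exp_re_mul_exp_im (jordanMul n), exp_smul_eq_exp_im_mul_exp_re (-jordanMul n),
    ← map_neg, mul_apply_eq_comp, mul_apply_eq_comp]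
  refine (norm_exp_I_smul_jordanMul_le hn.neg _ _).trans ?_
  rw [map_neg]
  exact (hre _).trans
    (mul_le_mul_of_nonneg_left (norm_exp_I_smul_jordanMul_le hn _ _) zero_le_two)

/-- The entire function `z ↦ exp (-z L_n) (E (exp (z L_n) k))` is bounded, hence constant, and its
derivative at `0` is `E (n * k) - n * E k`. -/
theorem map_mul_of_contractive_of_isSelfAdjoint (k : A) : E (n * k) = n * E k := by
  set f : ℂ → A := fun z => exp (z • -jordanMul n) (E (exp (z • jordanMul n) k))
  have hderiv : ∀ z, HasDerivAt f (exp (z • -jordanMul n)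
      (E (n * exp (z • jordanMul n) k) - n * E (exp (z • jordanMul n) k))) z := by
    intro z
    refine ((hasDerivAt_exp_smul_const (-jordanMul n) z).clm_apply (E.hasFDerivAt.comp_hasDerivAt z
      (hasDerivAt_exp_smul_apply (jordanMul n) k z))).congr_deriv ?_
    simp only [mul_apply_eq_comp, map_sub, neg_apply, jordanMul_apply, map_neg, Function.comp]
    abel
  have hconst : ∀ z, f z = f 0 := fun z =>
    Differentiable.apply_eq_apply_of_bounded (fun z => (hderiv z).differentiableAt)
      (isBounded_iff_forall_norm_le.2 ⟨2 * ‖k‖, by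
        rintro _ ⟨z, rfl⟩
        exact norm_exp_smul_neg_map_exp_smul_le he heN hE hEN hn hnN z k⟩) z 0
  have hzero : HasDerivAt f 0 0 := funext hconst ▸ hasDerivAt_const (0 : ℂ) (f 0)
  simpa [NormedSpace.exp_zero, sub_eq_zero] using (hderiv 0).unique hzero

omit hn in
theorem map_mul_of_contractive_of_fixes (k : A) : E (n * k) = n * E k := by
  have hstar : star n ∈ N := star_mem hnN
  have hre := map_mul_of_contractive_of_isSelfAdjoint he heN hE hEN (ℜ n).2
    (realPart_apply_coe n ▸ N.smul_of_tower_mem _ (add_mem hnN hstar)) k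
  have him := map_mul_of_contractive_of_isSelfAdjoint he heN hE hEN (ℑ n).2
    (imaginaryPart_apply_coe n ▸ SMulMemClass.smul_mem _
      (N.smul_of_tower_mem _ (sub_mem hnN hstar))) k
  rw [← realPart_add_I_smul_imaginaryPart n, add_mul, add_mul, smul_mul_assoc, smul_mul_assoc,
    map_add, map_smul, hre, him]

end ContractiveProjection

section Idempotent

variable {A : Type*} [JBStarAlgebra A] {e : A} (hee : e * e = e) (hse : IsSelfAdjoint e)

include hse in
theorem eq_zero_of_mul_eq_zero_of_isSelfAdjoint
    (h₀ : ∀ y, IsSelfAdjoint y → e * y = 0 → y = 0) {y : A} (hy : e * y = 0) : y = 0 := by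
  have hystar : e * star y = 0 := by rw [← hse.star_eq, ← star_mul', hy, star_zero]
  have hre : (ℜ y : A) = 0 := h₀ _ (ℜ y).2 <| by
    rw [realPart_apply_coe, mul_smul_comm, mul_add, hy, hystar, add_zero, smul_zero]
  have him : (ℑ y : A) = 0 := h₀ _ (ℑ y).2 <| by
    rw [imaginaryPart_apply_coe, mul_smul_comm, mul_smul_comm, mul_sub, hy, hystar, sub_zero,
      smul_zero, smul_zero]
  rw [← realPart_add_I_smul_imaginaryPart y, hre, him, smul_zero, add_zero]

include hee hse

theorem norm_le_one_of_mul_self : ‖e‖ ≤ 1 := by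
  have h := norm_jmul_self hse
  rw [hee] at h
  by_contra! h1
  exact (lt_self_pow₀ h1 one_lt_two).ne h

/-- Squaring maps `e + v` to `e + v * v`, so `‖e + v‖ ^ 2 ^ n` stays bounded. -/
theorem norm_add_le_one_of_mul_eq_zero {v : A} (hv : IsSelfAdjoint v) (hev : e * v = 0)
    (hv1 : ‖v‖ ≤ 1) : ‖e + v‖ ≤ 1 := by
  have hpow : ∀ (n : ℕ) (v : A), IsSelfAdjoint v → e * v = 0 → ‖v‖ ≤ 1 →
      ‖e + v‖ ^ 2 ^ n ≤ 2 := by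
    intro n
    induction n with
    | zero =>
      intro v _ _ hv1
      rw [pow_zero, pow_one]
      linarith [norm_add_le e v, norm_le_one_of_mul_self hee hse]
    | succ n ih =>
      intro v hv hev hv1
      have hsq : e + v * v = (e + v) * (e + v) := by
        rw [add_mul, mul_add, mul_add, hee, mul_comm v e, hev, add_zero, zero_add]
      have h := ih (v * v) (isSelfAdjoint_jmul hv hv) (peirce_zero_mul_self hee hev)
        (by rw [norm_jmul_self hv]; exact pow_le_one₀ (norm_nonneg _) hv1)
      rwa [hsq, norm_jmul_self (hse.add hv), ← pow_mul, ← pow_succ'] at h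
  by_contra! hlt
  obtain ⟨n, hn⟩ := pow_unbounded_of_one_lt 2 hlt
  have hmono := pow_le_pow_right₀ hlt.le (Nat.lt_two_pow_self (n := n)).le
  linarith [hpow n v hv hev hv1]

theorem isJordanUnit_of_peirce_zero (h₀ : ∀ y, e * y = 0 → y = 0) : IsJordanUnit e := by
  have hsa : ∀ x, IsSelfAdjoint x → e * x = x := by
    intro x hx
    have hw : IsSelfAdjoint (e * x - x) := (isSelfAdjoint_jmul hse hx).sub hx
    have hhalf : 2 • (e * (e * x - x)) = e * x - x := by
      have h := peirce_quadratic hee h₀ x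
      rw [mul_sub]
      linear_combination (norm := module) h
    have htriple := JBStarAlgebra.norm_triple (e * x - x)
    rw [hw.star_eq, add_sub_cancel_right, peirce_half_mul_self_mul hee h₀ hhalf, norm_zero]
      at htriple
    exact sub_eq_zero.1 (norm_eq_zero.1 (pow_eq_zero_iff three_ne_zero |>.1 htriple.symm))
  refine ⟨fun x => ?_⟩
  rw [← realPart_add_I_smul_imaginaryPart x, mul_add, mul_smul_comm, hsa _ (ℜ x).2, hsa _ (ℑ x).2]

end Idempotent

section NormalFaithfulState

variable {M : Type*} [JBStarAlgebra M] {F : Submodule ℂ (StrongDual ℂ M)} {φ : StrongDual ℂ M}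

theorem IsPredual.exists_apply_eq_norm (hF : IsPredual F) (hφ : φ ∈ F) (h0 : φ ≠ 0) :
    ∃ x : M, ‖x‖ = 1 ∧ φ x = ‖φ‖ := by
  let ψ : Pre F := ⟨φ, hφ⟩
  have hψ : ψ ≠ 0 := fun h => h0 (congrArg Subtype.val h)
  obtain ⟨g, hg, hgψ⟩ := exists_dual_vector ℂ ψ (norm_ne_zero_iff.2 hψ)
  obtain ⟨x, rfl⟩ := hF.surjective g
  exact ⟨x, by rw [← hF.isometry, hg], hgψ⟩

namespace IsNormalFaithfulState

variable (hφ : IsNormalFaithfulState F φ)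
include hφ

theorem norm_apply_le (x : M) : ‖φ x‖ ≤ ‖x‖ := by
  simpa [hφ.norm_eq_one] using φ.le_opNorm x

theorem re_apply_le (x : M) : (φ x).re ≤ ‖x‖ :=
  (Complex.re_le_norm _).trans (hφ.norm_apply_le x)

theorem re_nonneg {x : M} (hx : IsJordanPos x) : 0 ≤ (φ x).re := by
  obtain ⟨s, hs, rfl⟩ := hx
  exact (hφ.nonneg s hs).1

theorem im_eq_zero_of_isJordanPos {x : M} (hx : IsJordanPos x) : (φ x).im = 0 := by
  obtain ⟨s, hs, rfl⟩ := hx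
  exact (hφ.nonneg s hs).2

theorem eq_zero {x : M} (hx : IsJordanPos x) (h : (φ x).re = 0) : x = 0 := by
  have him := hφ.im_eq_zero_of_isJordanPos hx
  obtain ⟨s, hs, rfl⟩ := hx
  exact hφ.faithful s hs (Complex.ext h him)

theorem im_eq_zero {u : M} (hu : IsSelfAdjoint u) : (φ u).im = 0 := by
  obtain ⟨p, hp, hpu, -⟩ := exists_isJordanPos_mul_self_sub hu
  have h := hφ.im_eq_zero_of_isJordanPos hpu
  rwa [map_sub, Complex.sub_im,
    hφ.im_eq_zero_of_isJordanPos (isJordanPos_mul_self hp.isSelfAdjoint), zero_sub,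
    neg_eq_zero] at h

theorem re_apply_realPart (x : M) : (φ (ℜ x)).re = (φ x).re := by
  conv_rhs => rw [← realPart_add_I_smul_imaginaryPart x, map_add, map_smul, Complex.add_re,
    smul_eq_mul, Complex.I_mul_re, hφ.im_eq_zero (ℑ x).2, neg_zero, add_zero]

theorem exists_isSelfAdjoint_re_apply_eq_one (hF : IsPredual F) :
    ∃ u : M, IsSelfAdjoint u ∧ ‖u‖ ≤ 1 ∧ (φ u).re = 1 := by
  obtain ⟨x, hx, hφx⟩ := hF.exists_apply_eq_norm hφ.normal
    (norm_ne_zero_iff.1 (hφ.norm_eq_one ▸ one_ne_zero))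
  refine ⟨ℜ x, (ℜ x).2, hx ▸ realPart.norm_le x, ?_⟩
  rw [hφ.re_apply_realPart, hφx, hφ.norm_eq_one, Complex.ofReal_one, Complex.one_re]

theorem exists_mul_self_eq (hF : IsPredual F) :
    ∃ e : M, e * e = e ∧ IsSelfAdjoint e ∧ φ e = 1 := by
  obtain ⟨u, hu, hu1, hφu⟩ := hφ.exists_isSelfAdjoint_re_apply_eq_one hF
  obtain ⟨p, hp, hpu, hpnorm⟩ := exists_isJordanPos_mul_self_sub hu
  have hp1 : ‖p‖ ≤ 1 := (sq_le_one_iff₀ (norm_nonneg p)).1 (hpnorm ▸ hu1)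
  have hlower : 1 ≤ (φ (p * p)).re := by
    simpa [hφu] using hφ.re_nonneg hpu
  have hmiddle : (φ (p * p)).re ≤ ‖p‖ * (φ p).re := by
    simpa using hφ.re_nonneg hp.norm_smul_sub_mul_self
  have hpeq : ‖p‖ = 1 := by nlinarith [hφ.re_apply_le p, norm_nonneg p]
  have hφp : (φ p).re = 1 := by nlinarith [hφ.re_apply_le p]
  refine ⟨p, ?_, hp.isSelfAdjoint, Complex.ext hφp (by simpa using hφ.im_eq_zero hp.isSelfAdjoint)⟩
  have hsub := hp.norm_smul_sub_mul_self
  rw [hpeq, one_smul] at hsub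
  refine (sub_eq_zero.1 (hφ.eq_zero hsub (le_antisymm ?_ (hφ.re_nonneg hsub)))).symm
  rw [map_sub, Complex.sub_re]
  linarith

theorem eq_zero_of_mul_eq_zero {e y : M} (hee : e * e = e) (hse : IsSelfAdjoint e)
    (hφe : φ e = 1) (hy : e * y = 0) : y = 0 := by
  refine eq_zero_of_mul_eq_zero_of_isSelfAdjoint hse (fun y hy hey => ?_) hy
  by_contra hy0
  set w : M := ‖y‖⁻¹ • y with hw
  have hwsa : IsSelfAdjoint w := isSelfAdjoint_real_smul _ hy
  have hew : e * w = 0 := by rw [hw, mul_smul_comm, hey, smul_zero]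
  have hww : ‖w * w‖ = 1 := by
    rw [norm_jmul_self hwsa, hw, norm_smul, norm_inv, norm_norm,
      inv_mul_cancel₀ (norm_ne_zero_iff.2 hy0), one_pow]
  have hadd := (hφ.re_apply_le _).trans (norm_add_le_one_of_mul_eq_zero hee hse
    (isSelfAdjoint_jmul hwsa hwsa) (peirce_zero_mul_self hee hew) hww.le)
  rw [map_add, hφe, Complex.add_re, Complex.one_re] at hadd
  have hpos := isJordanPos_mul_self hwsa
  have hzero := hφ.eq_zero hpos (le_antisymm (by linarith) (hφ.re_nonneg hpos))
  rw [hzero, norm_zero] at hww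
  exact zero_ne_one hww

theorem exists_isJordanUnit (hF : IsPredual F) : ∃ e : M, IsJordanUnit e ∧ φ e = 1 := by
  obtain ⟨e, hee, hse, hφe⟩ := hφ.exists_mul_self_eq hF
  exact ⟨e, isJordanUnit_of_peirce_zero hee hse fun _ => hφ.eq_zero_of_mul_eq_zero hee hse hφe,
    hφe⟩

theorem realPart_eq_of_apply_eq_one {e x : M} (he : IsJordanUnit e) (hφe : φ e = 1)
    (hx : ‖x‖ ≤ 1) (hφx : φ x = 1) : (ℜ x : M) = e := by
  have hpos : IsJordanPos (e - (ℜ x : M)) := by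
    simpa using isJordanPos_smul_sub_of_norm_le he (ℜ x).2 ((realPart.norm_le x).trans hx)
  refine (sub_eq_zero.1 (hφ.eq_zero hpos ?_)).symm
  rw [map_sub, Complex.sub_re, hφe, hφ.re_apply_realPart, hφx, sub_self]

end IsNormalFaithfulState

end NormalFaithfulState

section BoundedFamily

variable {I M : Type*} [JBStarAlgebra M]

/-- The bounded families of elements of a JB*-algebra. They are turned into a JB*-algebra so that a
weak* limit along an ultrafilter becomes a contractive projection, onto the constant families. -/
abbrev BoundedFamily (I M : Type*) [JBStarAlgebra M] : Type _ := lp (fun _ : I => M) ⊤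

namespace BoundedFamily

/-- The family with given coordinates. -/
def mk (x : I → M) {C : ℝ} (h : ∀ i, ‖x i‖ ≤ C) : BoundedFamily I M :=
  ⟨x, memℓp_infty ⟨C, Set.forall_mem_range.2 h⟩⟩

theorem norm_coord_le (x : BoundedFamily I M) (i : I) : ‖x i‖ ≤ ‖x‖ :=
  lp.norm_apply_le_norm ENNReal.top_ne_zero x i

theorem norm_coord_mul_le (x y : BoundedFamily I M) (i : I) : ‖x i * y i‖ ≤ ‖x‖ * ‖y‖ :=
  (JBStarAlgebra.norm_jmul_le _ _).trans
    (mul_le_mul (norm_coord_le x i) (norm_coord_le y i) (norm_nonneg _) (norm_nonneg _))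

theorem norm_eq_norm_pow {x y : BoundedFamily I M} {n : ℕ} (hn : n ≠ 0)
    (h : ∀ i, ‖y i‖ = ‖x i‖ ^ n) : ‖y‖ = ‖x‖ ^ n := by
  have hn' : (0 : ℝ) < n := Nat.cast_pos.2 (Nat.pos_of_ne_zero hn)
  refine le_antisymm (lp.norm_le_of_forall_le (by positivity) fun i => ?_) ?_
  · exact (h i).trans_le (pow_le_pow_left₀ (norm_nonneg _) (norm_coord_le x i) n)
  · rw [← Real.rpow_natCast, ← Real.le_rpow_inv_iff_of_pos (norm_nonneg _) (norm_nonneg _) hn']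
    refine lp.norm_le_of_forall_le (by positivity) fun i => ?_
    rw [Real.le_rpow_inv_iff_of_pos (norm_nonneg _) (norm_nonneg _) hn', Real.rpow_natCast, ← h]
    exact norm_coord_le y i

noncomputable instance : Mul (BoundedFamily I M) where
  mul x y := mk (fun i => x i * y i) (norm_coord_mul_le x y)

noncomputable instance : JBStarAlgebra (BoundedFamily I M) where
  left_distrib x y z := lp.ext (funext fun i => mul_add (x i) (y i) (z i))
  right_distrib x y z := lp.ext (funext fun i => add_mul (x i) (y i) (z i))
  zero_mul x := lp.ext (funext fun i => zero_mul (x i))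
  mul_zero x := lp.ext (funext fun i => mul_zero (x i))
  mul_comm x y := lp.ext (funext fun i => mul_comm (x i) (y i))
  star_mul x y := lp.ext (funext fun i => star_mul (x i) (y i))
  star_add := star_add
  complete := CompleteSpace.complete
  __ := (inferInstance : NormedSpace ℂ (BoundedFamily I M))
  smul_assoc c x y := lp.ext (funext fun i => smul_mul_assoc c (x i) (y i))
  smul_comm c x y := lp.ext (funext fun i => (mul_smul_comm c (x i) (y i)).symm)
  star_smul := star_smul
  lmul_comm_rmul_rmul x y :=
    lp.ext (funext fun i => IsCommJordan.lmul_comm_rmul_rmul (x i) (y i))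
  norm_jmul_le x y := lp.norm_le_of_forall_le (by positivity) (norm_coord_mul_le x y)
  norm_jstar := norm_star
  norm_triple x := norm_eq_norm_pow three_ne_zero fun i => JBStarAlgebra.norm_triple (x i)

/-- The embedding of the algebra as the constant families. -/
noncomputable def const : M →⋆ₙₐ[ℂ] BoundedFamily I M where
  toFun m := mk (fun _ => m) fun _ => le_rfl
  map_zero' := rfl
  map_add' _ _ := rfl
  map_mul' _ _ := rfl
  map_smul' _ _ := rfl
  map_star' _ := rfl

theorem norm_const_le (m : M) : ‖(const m : BoundedFamily I M)‖ ≤ ‖m‖ :=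
  lp.norm_le_of_forall_le (norm_nonneg m) fun _ => le_rfl

theorem isJordanUnit_const {e : M} (he : IsJordanUnit e) :
    IsJordanUnit (const e : BoundedFamily I M) :=
  ⟨fun x => lp.ext (funext fun i => he.left (x i))⟩

/-- `x ↦ const (P x)` is a contractive projection that fixes the unit. -/
theorem map_const_mul {e : M} (he : IsJordanUnit e) {P : BoundedFamily I M →ₗ[ℂ] M}
    (hP : ∀ x, ‖P x‖ ≤ ‖x‖) (hPconst : ∀ m, P (const m) = m) (a : M) (x : BoundedFamily I M) :
    P (const a * x) = a * P x := by
  let E : BoundedFamily I M →L[ℂ] BoundedFamily I M :=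
    ((const : M →⋆ₙₐ[ℂ] BoundedFamily I M) : M →ₗ[ℂ] BoundedFamily I M) ∘ₗ P
      |>.mkContinuous 1 fun x => by rw [one_mul]; exact (norm_const_le _).trans (hP x)
  have hfix : ∀ y ∈ NonUnitalStarAlgHom.range (const : M →⋆ₙₐ[ℂ] BoundedFamily I M), E y = y := by
    rintro _ ⟨m, rfl⟩
    exact congrArg const (hPconst m)
  have h : const (P (const a * x)) = const a * const (P x) :=
    map_mul_of_contractive_of_fixes (isJordanUnit_const he)
      (NonUnitalStarAlgHom.mem_range_self _ e) (fun y => (norm_const_le _).trans (hP y)) hfix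
      (NonUnitalStarAlgHom.mem_range_self _ a) x
  rw [← hPconst (P (const a * x)), h, ← map_mul, hPconst]

end BoundedFamily

end BoundedFamily

section WeakStar

theorem exists_tendsto_ultrafilter_of_norm_le {I E : Type*} [SeminormedAddCommGroup E]
    [ProperSpace E] (U : Ultrafilter I) {z : I → E} {C : ℝ} (hz : ∀ i, ‖z i‖ ≤ C) :
    ∃ l, ‖l‖ ≤ C ∧ Filter.Tendsto z U (𝓝 l) := by
  have hball : (U.map z : Filter E) ≤ Filter.principal (Metric.closedBall 0 C) :=
    Filter.le_principal_iff.2 <|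
      Filter.Eventually.of_forall (f := (U : Filter I)) (by simpa using hz)
  obtain ⟨l, hl, hlim⟩ := (isCompact_closedBall (0 : E) C).ultrafilter_le_nhds (U.map z) hball
  exact ⟨l, by simpa using hl, hlim⟩

section

variable {X : Type*} [NormedAddCommGroup X] [NormedSpace ℂ X] {F : Submodule ℂ (StrongDual ℂ X)}

theorem IsPredual.ext (hF : IsPredual F) {x y : X} (h : ∀ ψ ∈ F, ψ x = ψ y) : x = y := by
  rw [← sub_eq_zero, ← norm_eq_zero, ← hF.isometry, norm_eq_zero]
  ext ψ
  rw [ContinuousLinearMap.flip_apply, map_sub, zero_apply, sub_eq_zero]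
  exact h (Pre.toDual F ψ) ψ.2

theorem IsPredual.exists_tendsto_ultrafilter {I : Type*} (hF : IsPredual F) (U : Ultrafilter I)
    {x : I → X} {C : ℝ} (hC : 0 ≤ C) (hx : ∀ i, ‖x i‖ ≤ C) :
    ∃ m : X, ‖m‖ ≤ C ∧ ∀ ψ ∈ F, Filter.Tendsto (fun i => ψ (x i)) U (𝓝 (ψ m)) := by
  have hbound : ∀ (ψ : Pre F) (i : I), ‖Pre.toDual F ψ (x i)‖ ≤ C * ‖ψ‖ := fun ψ i =>
    ((Pre.toDual F ψ).le_of_opNorm_le_of_le le_rfl (hx i)).trans_eq (mul_comm _ _)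
  choose l hl hlim using fun ψ => exists_tendsto_ultrafilter_of_norm_le U (hbound ψ)
  let g : StrongDual ℂ (Pre F) := LinearMap.mkContinuous
    { toFun := l
      map_add' := fun ψ ψ' => tendsto_nhds_unique (hlim (ψ + ψ')) (by
        simpa using (hlim ψ).add (hlim ψ'))
      map_smul' := fun c ψ => tendsto_nhds_unique (hlim (c • ψ)) (by
        simpa using (hlim ψ).const_mul c) } C hl
  obtain ⟨m, hm⟩ := hF.surjective g
  refine ⟨m, ?_, fun ψ hψ => ?_⟩
  · rw [← hF.isometry, hm]
    exact LinearMap.mkContinuous_norm_le _ hC _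
  · have hψm : l (⟨ψ, hψ⟩ : F) = ψ m := (DFunLike.congr_fun hm (⟨ψ, hψ⟩ : F)).symm
    exact hψm ▸ hlim (⟨ψ, hψ⟩ : F)

theorem exists_mem_span_norm_sub_le (s : Finset (StrongDual ℂ X)) (χ : StrongDual ℂ X) {ε : ℝ}
    (hε : 0 ≤ ε) (h : ∀ x, ‖x‖ ≤ 1 → (∀ ψ ∈ s, ψ x = 0) → ‖χ x‖ ≤ ε) :
    ∃ θ ∈ Submodule.span ℂ (s : Set (StrongDual ℂ X)), ‖χ - θ‖ ≤ ε := by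
  let V : Submodule ℂ X := ⨅ ψ : s, LinearMap.ker (ψ : StrongDual ℂ X).toLinearMap
  have hV : ∀ x ∈ V, ∀ ψ ∈ s, ψ x = 0 := fun x hx ψ hψ => (Submodule.mem_iInf _).1 hx ⟨ψ, hψ⟩
  obtain ⟨g, hg, hgnorm⟩ := exists_extension_norm_eq V (χ.comp V.subtypeL)
  have hker : V ≤ LinearMap.ker (χ - g).toLinearMap := fun x hx => by
    simpa [sub_eq_zero] using (hg ⟨x, hx⟩).symm
  have hspan : (χ - g).toLinearMap ∈
      (Submodule.span ℂ (s : Set (StrongDual ℂ X))).map (ContinuousLinearMap.coeLM ℂ) := by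
    rw [Submodule.map_span]
    refine Submodule.span_mono ?_ (mem_span_of_iInf_ker_le_ker hker)
    rintro _ ⟨ψ, rfl⟩
    exact ⟨ψ, ψ.2, rfl⟩
  obtain ⟨θ, hθ, hθg⟩ := hspan
  refine ⟨θ, hθ, ?_⟩
  rw [ContinuousLinearMap.coe_injective hθg, sub_sub_cancel, hgnorm]
  exact ContinuousLinearMap.opNorm_le_of_unit_norm hε fun x hx => h x hx.le (hV x x.2)

theorem IsPredual.exists_norm_le_one_of_notMem (hF : IsPredual F) {χ : StrongDual ℂ X}
    (hχ : χ ∉ F) : ∃ ε > 0, ∀ s : Finset F, ∃ x : X, ‖x‖ ≤ 1 ∧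
      (∀ ψ ∈ s, (ψ : StrongDual ℂ X) x = 0) ∧ ε < ‖χ x‖ := by
  obtain ⟨ε, hε, hball⟩ := Metric.isOpen_iff.1 hF.isClosed.isOpen_compl χ hχ
  refine ⟨ε / 2, half_pos hε, fun s => ?_⟩
  by_contra! hcon
  classical
  obtain ⟨θ, hθ, hχθ⟩ := exists_mem_span_norm_sub_le (s.image Subtype.val) χ (half_pos hε).le
    fun x hx hs => hcon x hx fun ψ hψ => hs ψ (Finset.mem_image_of_mem _ hψ)
  have hθF : θ ∈ F := Submodule.span_le.2 (by simp +contextual [Set.subset_def]) hθ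
  refine hball ?_ hθF
  rw [Metric.mem_ball, dist_eq_norm, norm_sub_rev]
  linarith

end

namespace IsPredual

variable {I M : Type*} [JBStarAlgebra M] {F : Submodule ℂ (StrongDual ℂ M)} (hF : IsPredual F)
include hF

theorem exists_limit_map (U : Ultrafilter I) :
    ∃ P : BoundedFamily I M →ₗ[ℂ] M, (∀ x, ‖P x‖ ≤ ‖x‖) ∧
      ∀ x, ∀ ψ ∈ F, Filter.Tendsto (fun i => ψ (x i)) U (𝓝 (ψ (P x))) := by
  choose P hPnorm hP using fun x : BoundedFamily I M =>
    hF.exists_tendsto_ultrafilter U (norm_nonneg x) (BoundedFamily.norm_coord_le x)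
  refine ⟨{ toFun := P, map_add' := fun x y => ?_, map_smul' := fun c x => ?_ }, hPnorm, hP⟩
  · refine hF.ext fun ψ hψ => tendsto_nhds_unique (hP (x + y) ψ hψ) ?_
    simpa using (hP x ψ hψ).add (hP y ψ hψ)
  · refine hF.ext fun ψ hψ => tendsto_nhds_unique (hP (c • x) ψ hψ) ?_
    simpa using (hP x ψ hψ).const_mul c

variable {e : M} (he : IsJordanUnit e)
include he

theorem tendsto_mul_zero (U : Ultrafilter I) {x : I → M} {C : ℝ} (hx : ∀ i, ‖x i‖ ≤ C)
    (hlim : ∀ ψ ∈ F, Filter.Tendsto (fun i => ψ (x i)) U (𝓝 0)) (a : M) {ψ : StrongDual ℂ M}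
    (hψ : ψ ∈ F) : Filter.Tendsto (fun i => ψ (a * x i)) U (𝓝 0) := by
  obtain ⟨P, hPnorm, hP⟩ := hF.exists_limit_map U
  have hPconst : ∀ m, P (.const m) = m := fun m =>
    hF.ext fun ψ hψ => tendsto_nhds_unique (hP _ ψ hψ) tendsto_const_nhds
  have hPx : P (.mk x hx) = 0 := hF.ext fun ψ hψ => by
    rw [map_zero]
    exact tendsto_nhds_unique (hP _ ψ hψ) (hlim ψ hψ)
  have h := hP (.const a * .mk x hx) ψ hψ
  rwa [BoundedFamily.map_const_mul he hPnorm hPconst, hPx, mul_zero, map_zero] at h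

/-- Otherwise there is a bounded net `x` that tends to zero weak* while `ψ (a * x)` stays away
from zero. -/
theorem comp_jordanMul_mem (a : M) {ψ : StrongDual ℂ M} (hψ : ψ ∈ F) :
    ψ.comp (jordanMul a) ∈ F := by
  by_contra hnot
  obtain ⟨ε, hε, hex⟩ := hF.exists_norm_le_one_of_notMem hnot
  choose x hx hxs hψx using hex
  let U : Ultrafilter (Finset F) := .of Filter.atTop
  have hlim : ∀ ψ ∈ F, Filter.Tendsto (fun s => ψ (x s)) U (𝓝 0) := fun ψ hψ => by
    refine tendsto_const_nhds.congr' (Filter.EventuallyEq.symm ?_)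
    filter_upwards [Ultrafilter.of_le Filter.atTop (Filter.eventually_ge_atTop {⟨ψ, hψ⟩})] with s hs
    exact hxs s ⟨ψ, hψ⟩ (Finset.singleton_subset_iff.1 hs)
  have hzero := (hF.tendsto_mul_zero he U hx hlim a hψ).norm
  rw [norm_zero] at hzero
  obtain ⟨s, hs⟩ := (hzero.eventually_lt_const hε).exists
  exact lt_asymm hs (hψx s)

end IsPredual

end WeakStar

section StarHom

variable {A B : Type*} [JBStarAlgebra A] [JBStarAlgebra B] {e : A}

theorem norm_starHom_le (T : A →⋆ₙₐ[ℂ] B) (he : IsJordanUnit e) (hTe : IsJordanUnit (T e))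
    (x : A) : ‖T x‖ ≤ ‖x‖ := by
  have hpos : IsPositiveMap T := by
    rintro _ ⟨s, hs, rfl⟩
    rw [map_mul]
    exact isJordanPos_mul_self (hs.map T)
  have hbound : ∀ x, ‖T x‖ ≤ 2 * ‖x‖ := hpos.norm_map_le (T := (T : A →ₗ[ℂ] B)) he hTe rfl
  refine norm_map_le_of_map_jordanTriple hbound (fun x => ?_) x
  simp only [jordanTriple, map_sub, map_add, map_mul, map_star]

theorem IsJordanUnit.map_starAlgEquiv (he : IsJordanUnit e) (α : A ≃⋆ₐ[ℂ] B) :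
    IsJordanUnit (α e) where
  left y := by
    obtain ⟨x, rfl⟩ := EquivLike.surjective α y
    rw [← map_mul, he.left]

theorem norm_starAlgEquiv_le (he : IsJordanUnit e) (α : A ≃⋆ₐ[ℂ] B) (x : A) : ‖α x‖ ≤ ‖x‖ :=
  norm_starHom_le (α : A →⋆ₙₐ[ℂ] B) he (he.map_starAlgEquiv α) x

theorem norm_starAlgEquiv (he : IsJordanUnit e) (α : A ≃⋆ₐ[ℂ] B) (x : A) : ‖α x‖ = ‖x‖ :=
  (norm_starAlgEquiv_le he α x).antisymm
    (by simpa using norm_starAlgEquiv_le (he.map_starAlgEquiv α) α.symm (α x))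

end StarHom

section StateInvariance

variable {M : Type*} [JBStarAlgebra M] {F : Submodule ℂ (StrongDual ℂ M)} {φ : StrongDual ℂ M}

theorem star_mul_self_eq_add (m : M) : star m * m = ℜ m * ℜ m + ℑ m * ℑ m := by
  conv_lhs => rw [← realPart_add_I_smul_imaginaryPart m]
  rw [star_add, star_smul, (ℜ m).2.star_eq, (ℑ m).2.star_eq, add_mul, mul_add, mul_add,
    smul_mul_smul_comm, mul_smul_comm, smul_mul_assoc, mul_comm (ℑ m : M) (ℜ m)]
  simp

namespace IsNormalFaithfulState

variable (hφ : IsNormalFaithfulState F φ)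
include hφ

theorem eq_zero_of_re_apply_mul_self {u : M} (hu : IsSelfAdjoint u) (h : (φ (u * u)).re = 0) :
    u = 0 := by
  have hnorm := norm_jmul_self hu
  rw [hφ.eq_zero (isJordanPos_mul_self hu) h, norm_zero] at hnorm
  exact norm_eq_zero.1 (pow_eq_zero_iff two_ne_zero |>.1 hnorm.symm)

theorem eq_zero_of_star_mul_self {m : M} (h : φ (star m * m) = 0) : m = 0 := by
  have hre := congrArg Complex.re h
  rw [star_mul_self_eq_add, map_add, Complex.add_re, Complex.zero_re] at hre
  have hreal := (hφ.nonneg _ (ℜ m).2).1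
  have himag := (hφ.nonneg _ (ℑ m).2).1
  rw [← realPart_add_I_smul_imaginaryPart m,
    hφ.eq_zero_of_re_apply_mul_self (ℜ m).2 (by linarith),
    hφ.eq_zero_of_re_apply_mul_self (ℑ m).2 (by linarith), smul_zero, add_zero]

theorem jtranslate_mem (hF : IsPredual F) (x : M) : jtranslate φ x ∈ F := by
  obtain ⟨e, he, -⟩ := hφ.exists_isJordanUnit hF
  exact hF.comp_jordanMul_mem he x hφ.normal

/-- Otherwise Hahn–Banach gives a nonzero functional on the predual vanishing at all `φ_x`; it is
evaluation at some `m`, and `φ (star m * m) = 0`. -/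
theorem predual_le_of_jtranslate_mem (hF : IsPredual F) {G : Submodule ℂ (StrongDual ℂ M)}
    (hG : IsClosed (G : Set (StrongDual ℂ M))) (h : ∀ x, jtranslate φ x ∈ G) : F ≤ G := by
  intro ψ hψ
  by_contra hψG
  let S : Submodule ℂ (Pre F) := G.comap (Pre.toDual F).toLinearMap
  have : IsClosed (S : Set (Pre F)) := hG.preimage (Pre.toDual F).continuous
  have hψS : S.mkQL (⟨ψ, hψ⟩ : F) ≠ 0 := fun h0 => hψG ((Submodule.Quotient.mk_eq_zero S).1 h0)
  obtain ⟨g, hg⟩ := SeparatingDual.exists_ne_zero (R := ℂ) hψS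
  obtain ⟨m, hm⟩ := hF.surjective (g.comp S.mkQL)
  have hval (ρ : F) : (ρ : StrongDual ℂ M) m = g (S.mkQL ρ) := DFunLike.congr_fun hm ρ
  have hzero : φ (star m * m) = 0 := by
    refine (hval ⟨jtranslate φ (star m), hφ.jtranslate_mem hF _⟩).trans ?_
    have hmem : (⟨jtranslate φ (star m), hφ.jtranslate_mem hF _⟩ : F) ∈ S := h (star m)
    exact (congrArg g ((Submodule.Quotient.mk_eq_zero S).2 hmem)).trans (map_zero g)
  refine hg ((hval ⟨ψ, hψ⟩).symm.trans ?_)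
  rw [hφ.eq_zero_of_star_mul_self hzero, map_zero]

theorem comp_mem_of_adjoint (hF : IsPredual F) {M' : Type*} [JBStarAlgebra M']
    {F' : Submodule ℂ (StrongDual ℂ M')} {φ' : StrongDual ℂ M'}
    (hφ' : IsNormalFaithfulState F' φ') (hF' : IsPredual F') {T : M → M'} {S : M' →L[ℂ] M}
    (hTS : ∀ x y, φ' (T x * y) = φ (x * S y)) {ψ : StrongDual ℂ M} (hψ : ψ ∈ F) :
    ψ.comp S ∈ F' := by
  let R : StrongDual ℂ M →L[ℂ] StrongDual ℂ M' := ContinuousLinearMap.precomp ℂ S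
  refine hφ.predual_le_of_jtranslate_mem hF (G := F'.comap R.toLinearMap)
    (hF'.isClosed.preimage R.continuous) (fun x => ?_) hψ
  have hR : R (jtranslate φ x) = jtranslate φ' (T x) :=
    ContinuousLinearMap.ext fun y => (hTS x y).symm
  exact Submodule.mem_comap.2 (hR ▸ hφ'.jtranslate_mem hF' (T x))

section Projection

variable (hF : IsPredual F) {N : NonUnitalStarSubalgebra ℂ M} {E : M →L[ℂ] M}
  (hE : ∀ x, ‖E x‖ ≤ ‖x‖) (hφE : ∀ x, φ (E x) = φ x) (hmem : ∀ x, E x ∈ N)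
include hE hφE hmem

theorem unit_mem_of_contractive {e : M} (he : IsJordanUnit e) (hφe : φ e = 1) : e ∈ N := by
  have hstar : star (E e) ∈ N := star_mem (hmem e)
  rw [← hφ.realPart_eq_of_apply_eq_one he hφe ((hE e).trans he.norm_le_one) ((hφE e).trans hφe),
    realPart_apply_coe]
  exact N.smul_of_tower_mem _ (add_mem (hmem e) hstar)

include hF

theorem apply_mul_map (hEN : ∀ x ∈ N, E x = x) {n : M} (hn : n ∈ N) (y : M) :
    φ (n * E y) = φ (n * y) := by
  obtain ⟨e, he, hφe⟩ := hφ.exists_isJordanUnit hF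
  rw [← hφE (n * y), map_mul_of_contractive_of_fixes he
    (hφ.unit_mem_of_contractive hE hφE hmem he hφe) hE hEN hn]

theorem apply_map_mul (hEN : ∀ x ∈ N, E x = x) (x y : M) : φ (E x * y) = φ (x * E y) := by
  rw [← hφ.apply_mul_map hF hE hφE hmem hEN (hmem x), mul_comm x,
    ← hφ.apply_mul_map hF hE hφE hmem hEN (hmem y), mul_comm (E x)]

end Projection

end IsNormalFaithfulState

end StateInvariance

/-- A linear map of the surrounding spaces is contractive from `W` to `W'` if it maps `W` into `W'`
and does not increase the norm. -/
def NormedSub.Contracts {V V' : Type*} [AddCommGroup V] [Module ℂ V] [AddCommGroup V'] [Module ℂ V']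
    (W : NormedSub V) (W' : NormedSub V') (Φ : V →ₗ[ℂ] V') : Prop :=
  ∀ x : W.carrier, ∃ hx : Φ x ∈ W'.carrier, W'.nrm ⟨Φ x, hx⟩ ≤ W.nrm x

namespace NormedSub.Contracts

variable {V V' : Type*} [AddCommGroup V] [Module ℂ V] [AddCommGroup V'] [Module ℂ V']
  {W : NormedSub V} {W' : NormedSub V'} {Φ : V →ₗ[ℂ] V'} (h : W.Contracts W' Φ)

/-- The map between normed subspaces to which a contractive map of the surrounding spaces
restricts. -/
noncomputable def map : W.Elem →L[ℂ] W'.Elem :=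
  LinearMap.mkContinuous
    (Φ.restrict (p := W.carrier) (q := W'.carrier) fun x hx => (h ⟨x, hx⟩).1 :
      W.Elem →ₗ[ℂ] W'.Elem) 1 fun x => by
    rw [one_mul]
    exact (h x).2

theorem val_map (x : W.Elem) : (h.map x).val = Φ x.val := rfl

theorem norm_map_le (x : W.Elem) : ‖h.map x‖ ≤ ‖x‖ := (h x).2

end NormedSub.Contracts

namespace Interp

variable {X₀ X₁ V Y₀ Y₁ W : Type*} [NormedAddCommGroup X₀] [NormedSpace ℂ X₀]
  [NormedAddCommGroup X₁] [NormedSpace ℂ X₁] [NormedAddCommGroup V] [NormedSpace ℂ V]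
  [NormedAddCommGroup Y₀] [NormedSpace ℂ Y₀]
  [NormedAddCommGroup Y₁] [NormedSpace ℂ Y₁] [NormedAddCommGroup W] [NormedSpace ℂ W]
  {j₀ : X₀ →L[ℂ] V} {j₁ : X₁ →L[ℂ] V} {k₀ : Y₀ →L[ℂ] W} {k₁ : Y₁ →L[ℂ] W}

theorem inl_eq_inr {x₀ : X₀} {x₁ : X₁} (h : j₀ x₀ = j₁ x₁) : inl j₀ j₁ x₀ = inr j₀ j₁ x₁ :=
  (Submodule.Quotient.eq _).2 (by simp [sumMap, h])

theorem exists_inl_add_inr (x : Sum j₀ j₁) : ∃ x₀ x₁, x = inl j₀ j₁ x₀ + inr j₀ j₁ x₁ := by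
  obtain ⟨y, rfl⟩ := Submodule.mkQ_surjective _ x
  refine ⟨y.fst, y.snd, ?_⟩
  change _ = (sumMap j₀ j₁).ker.mkQ (WithLp.toLp 1 (y.fst, 0)) +
    (sumMap j₀ j₁).ker.mkQ (WithLp.toLp 1 (0, y.snd))
  rw [← map_add, ← WithLp.toLp_add, Prod.mk_add_mk, add_zero, zero_add]
  rfl

theorem right_nrm_inr (hj : Function.Injective j₁) {x : X₁}
    (hx : inr j₀ j₁ x ∈ (right j₀ j₁ hj).carrier) :
    (right j₀ j₁ hj).nrm ⟨inr j₀ j₁ x, hx⟩ = ‖x‖ :=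
  congrArg norm ((LinearEquiv.symm_apply_eq _).2 (Subtype.ext rfl) :
    (LinearEquiv.ofInjective (inr j₀ j₁) (inr_injective hj)).symm ⟨inr j₀ j₁ x, hx⟩ = x)

variable (j₀ j₁ k₀ k₁) in
/-- A contractive morphism of couples: two contractions that agree on the intersection of the
couple. -/
structure Contraction where
  left : X₀ →L[ℂ] Y₀
  right : X₁ →L[ℂ] Y₁
  norm_left_le : ∀ x, ‖left x‖ ≤ ‖x‖
  norm_right_le : ∀ x, ‖right x‖ ≤ ‖x‖
  compat : ∀ {x₀ x₁}, j₀ x₀ = j₁ x₁ → k₀ (left x₀) = k₁ (right x₁)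

/-- Composition of a function vanishing at infinity with a linear map. -/
def mapZeroAtInfty (T : X₀ →L[ℂ] Y₀) (g : C₀(ℝ, X₀)) : C₀(ℝ, Y₀) where
  toFun t := T (g t)
  continuous_toFun := T.continuous.comp g.continuous
  zero_at_infty' := (T.continuous.tendsto' 0 0 (map_zero T)).comp g.zero_at_infty'

theorem norm_mapZeroAtInfty_le {T : X₀ →L[ℂ] Y₀} (hT : ∀ x, ‖T x‖ ≤ ‖x‖) (g : C₀(ℝ, X₀)) :
    ‖mapZeroAtInfty T g‖ ≤ ‖g‖ := by
  rw [← ZeroAtInftyContinuousMap.norm_toBCF_eq_norm, ← ZeroAtInftyContinuousMap.norm_toBCF_eq_norm]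
  exact (BoundedContinuousFunction.norm_le (norm_nonneg _)).2 fun t =>
    (hT _).trans (g.toBCF.norm_coe_le_norm t)

namespace Contraction

variable (Φ : Contraction j₀ j₁ k₀ k₁)

/-- The map of sums `x₀ + x₁ ↦ Φ x₀ + Φ x₁` induced by a morphism of couples. -/
noncomputable def sum : Sum j₀ j₁ →L[ℂ] Sum k₀ k₁ :=
  (sumMap j₀ j₁).ker.liftQL
    ((sumMap k₀ k₁).ker.mkQL ∘L
      (WithLp.prodContinuousLinearEquiv 1 ℂ Y₀ Y₁).symm.toContinuousLinearMap ∘L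
      (Φ.left.prodMap Φ.right) ∘L
      (WithLp.prodContinuousLinearEquiv 1 ℂ X₀ X₁).toContinuousLinearMap) (by
    intro x hx
    refine (Submodule.Quotient.mk_eq_zero _).2 ?_
    have hx : j₀ x.fst = j₁ (-x.snd) := by rw [map_neg]; exact eq_neg_of_add_eq_zero_left hx
    have h := Φ.compat hx
    rw [map_neg, map_neg, eq_neg_iff_add_eq_zero] at h
    exact h)

theorem sum_inl (x : X₀) : Φ.sum (inl j₀ j₁ x) = inl k₀ k₁ (Φ.left x) := by
  change (sumMap k₀ k₁).ker.mkQ (WithLp.toLp 1 (Φ.left x, Φ.right 0)) = _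
  rw [map_zero]
  rfl

theorem sum_inr (x : X₁) : Φ.sum (inr j₀ j₁ x) = inr k₀ k₁ (Φ.right x) := by
  change (sumMap k₀ k₁).ker.mkQ (WithLp.toLp 1 (Φ.left 0, Φ.right x)) = _
  rw [map_zero]
  rfl

theorem sum_sum_eq_self {Ψ : Contraction k₀ k₁ j₀ j₁} (hleft : ∀ x, Ψ.left (Φ.left x) = x)
    (hright : ∀ x, Ψ.right (Φ.right x) = x) (x : Sum j₀ j₁) : Ψ.sum (Φ.sum x) = x := by
  obtain ⟨x₀, x₁, rfl⟩ := exists_inl_add_inr x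
  simp only [map_add, sum_inl, sum_inr, hleft, hright]

theorem map_isAdmissible {f : ℂ → Sum j₀ j₁} {g₀ : C₀(ℝ, X₀)} {g₁ : C₀(ℝ, X₁)}
    (h : IsAdmissible j₀ j₁ f g₀ g₁) :
    IsAdmissible k₀ k₁ (fun z => Φ.sum (f z)) (mapZeroAtInfty Φ.left g₀)
      (mapZeroAtInfty Φ.right g₁) where
  continuousOn := Φ.sum.continuous.comp_continuousOn h.continuousOn
  bounded := by
    obtain ⟨C, hC⟩ := h.bounded
    exact ⟨‖Φ.sum‖ * C, fun z hz => Φ.sum.le_opNorm_of_le (hC z hz)⟩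
  holomorphic := Φ.sum.differentiable.comp_differentiableOn h.holomorphic
  left t := by rw [h.left, sum_inl]; rfl
  right t := by rw [h.right, sum_inr]; rfl

theorem contracts_interp (θ : unitInterval) :
    (interp j₀ j₁ θ).Contracts (interp k₀ k₁ θ) Φ.sum.toLinearMap := by
  rintro ⟨x, hx⟩
  have hmem : Φ.sum x ∈ space k₀ k₁ θ := by
    obtain ⟨f, g₀, g₁, h, rfl⟩ := hx
    exact ⟨_, _, _, Φ.map_isAdmissible h, rfl⟩
  refine ⟨hmem, le_csInf (norms_nonempty hx) ?_⟩
  rintro _ ⟨f, g₀, g₁, h, rfl, rfl⟩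
  refine (csInf_le (norms_bddBelow _ _) ⟨_, _, _, Φ.map_isAdmissible h, rfl, rfl⟩).trans ?_
  exact max_le_max (norm_mapZeroAtInfty_le Φ.norm_left_le g₀)
    (norm_mapZeroAtInfty_le Φ.norm_right_le g₁)

theorem contracts_right (hj : Function.Injective j₁) (hk : Function.Injective k₁) :
    (Interp.right j₀ j₁ hj).Contracts (Interp.right k₀ k₁ hk) Φ.sum.toLinearMap := by
  rintro ⟨_, x, rfl⟩
  rw [ContinuousLinearMap.coe_coe, sum_inr]
  exact ⟨⟨_, rfl⟩, (right_nrm_inr hk _).trans_le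
    ((Φ.norm_right_le x).trans_eq (right_nrm_inr hj _).symm)⟩

end Contraction

theorem norm_cexp_sq_sub (z : ℂ) (θ : ℝ) :
    ‖Complex.exp (z ^ 2 - (θ : ℂ) ^ 2)‖ = Real.exp (z.re ^ 2 - z.im ^ 2 - θ ^ 2) := by
  rw [Complex.norm_exp]
  congr 1
  simp [pow_two]

/-- The boundary values `t ↦ exp ((a + i t)² - θ²) x` on the line `re z = a` of the function
`z ↦ exp (z² - θ²) x`, whose value at `θ` is `x`. -/
noncomputable def gaussian (a θ : ℝ) (x : X₀) : C₀(ℝ, X₀) where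
  toFun t := Complex.exp ((a + t * Complex.I) ^ 2 - (θ : ℂ) ^ 2) • x
  continuous_toFun := by fun_prop
  zero_at_infty' := by
    rw [tendsto_zero_iff_norm_tendsto_zero]
    have hsq : Filter.Tendsto (fun t : ℝ => ‖t‖ ^ 2) (Filter.cocompact ℝ) Filter.atTop :=
      (Filter.tendsto_pow_atTop two_ne_zero).comp tendsto_norm_cocompact_atTop
    have hexp : Filter.Tendsto (fun t : ℝ => Real.exp (a ^ 2 - θ ^ 2 + -‖t‖ ^ 2) * ‖x‖)
        (Filter.cocompact ℝ) (𝓝 (0 * ‖x‖)) :=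
      (Real.tendsto_exp_atBot.comp
        (tendsto_const_nhds.add_atBot (Filter.tendsto_neg_atTop_atBot.comp hsq))).mul_const _
    rw [zero_mul] at hexp
    refine hexp.congr fun t => ?_
    rw [norm_smul, norm_cexp_sq_sub, Real.norm_eq_abs, sq_abs]
    congr 2
    simp only [Complex.add_re, Complex.ofReal_re, Complex.re_ofReal_mul, Complex.I_re, mul_zero,
      add_zero, Complex.add_im, Complex.ofReal_im, Complex.im_ofReal_mul, Complex.I_im, mul_one,
      zero_add]
    ring

theorem inl_mem_space {x₀ : X₀} {x₁ : X₁} (h : j₀ x₀ = j₁ x₁) (θ : unitInterval) :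
    inl j₀ j₁ x₀ ∈ space j₀ j₁ θ := by
  refine ⟨fun z => Complex.exp (z ^ 2 - ((θ : ℝ) : ℂ) ^ 2) • inl j₀ j₁ x₀, gaussian 0 θ x₀,
    gaussian 1 θ x₁, ⟨by fun_prop, ?_, by fun_prop, fun t => ?_, fun t => ?_⟩, by simp⟩
  · refine ⟨Real.exp 1 * ‖inl j₀ j₁ x₀‖, fun z hz => ?_⟩
    rw [norm_smul, norm_cexp_sq_sub]
    gcongr
    nlinarith [sq_nonneg z.im, sq_nonneg (θ : ℝ), hz.1, hz.2]
  · simp [gaussian]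
  · simp [gaussian, inl_eq_inr h]

end Interp

section Retraction

variable {𝕜 X Y : Type*} [NormedField 𝕜] [NormedAddCommGroup X] [NormedSpace 𝕜 X]
  [NormedAddCommGroup Y] [NormedSpace 𝕜 Y]

/-- A contraction with a contractive left inverse, as a linear isometry. -/
def isometryOfRetraction (T : X →L[𝕜] Y) (S : Y →L[𝕜] X) (hT : ∀ x, ‖T x‖ ≤ ‖x‖)
    (hS : ∀ y, ‖S y‖ ≤ ‖y‖) (hST : ∀ x, S (T x) = x) : X →ₗᵢ[𝕜] Y where
  toLinearMap := T
  norm_map' x := (hT x).antisymm (by simpa only [hST] using hS (T x))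

theorem nonempty_isometryEquiv_range_comp {T : X →L[𝕜] Y} {S : Y →L[𝕜] X}
    (hT : ∀ x, ‖T x‖ ≤ ‖x‖) (hS : ∀ y, ‖S y‖ ≤ ‖y‖) (hST : ∀ x, S (T x) = x) :
    Nonempty (X ≃ₗᵢ[𝕜] (T.comp S).range) := by
  have hrange : (T.comp S).range = LinearMap.range (T : X →ₗ[𝕜] Y) :=
    LinearMap.range_comp_of_range_eq_top _
      (LinearMap.range_eq_top.2 (Function.LeftInverse.surjective hST))
  rw [hrange]
  exact ⟨(isometryOfRetraction T S hT hS hST).equivRange⟩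

end Retraction

section AdjointPair

variable {M M' : Type*} [JBStarAlgebra M] [JBStarAlgebra M']
  {F : Submodule ℂ (StrongDual ℂ M)} {φ : StrongDual ℂ M}
  {F' : Submodule ℂ (StrongDual ℂ M')} {φ' : StrongDual ℂ M'}

theorem IsNormalFaithfulState.ofAlg_mem (hφ : IsNormalFaithfulState F φ) (hF : IsPredual F)
    (p : ℝ) (hp : 1 ≤ p) (x : M) : ofAlg F φ x ∈ (LpSub F φ p hp).carrier := by
  have h : jtranslate φ x = Pre.toDual F (⟨jtranslate φ x, hφ.jtranslate_mem hF x⟩ : F) := rfl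
  unfold LpSub
  split_ifs
  · exact ⟨_, (Interp.inl_eq_inr h).symm⟩
  · exact Interp.inl_mem_space h _

/-- The restriction to preduals of the transpose of a linear map. -/
noncomputable def preComp (T : M' →L[ℂ] M) (hT : ∀ ψ ∈ F, ψ.comp T ∈ F') : Pre F →L[ℂ] Pre F' :=
  LinearMap.mkContinuous
    ((ContinuousLinearMap.precomp ℂ T).toLinearMap.restrict (p := F) (q := F') hT :
      Pre F →ₗ[ℂ] Pre F') ‖T‖ fun ψ => by
    rw [mul_comm]
    exact ContinuousLinearMap.opNorm_comp_le (Pre.toDual F ψ) T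

theorem norm_preComp_le {T : M' →L[ℂ] M} {hT : ∀ ψ ∈ F, ψ.comp T ∈ F'} (h : ∀ x, ‖T x‖ ≤ ‖x‖)
    (ψ : Pre F) : ‖preComp T hT ψ‖ ≤ ‖ψ‖ :=
  (ContinuousLinearMap.opNorm_comp_le (Pre.toDual F ψ) T).trans <|
    mul_le_of_le_one_right (norm_nonneg _) <|
      ContinuousLinearMap.opNorm_le_bound _ zero_le_one fun x => by simpa using h x

/-- Two weak* continuous contractions that are adjoint to each other for the bilinear forms
`(x, y) ↦ φ (x * y)` and `(x, y) ↦ φ' (x * y)`. Such pairs are what acts on the spaces `L^p`: the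
map acts on the algebra and the transpose of the adjoint extends it to the predual. -/
structure AdjointPair (F : Submodule ℂ (StrongDual ℂ M)) (φ : StrongDual ℂ M)
    (F' : Submodule ℂ (StrongDual ℂ M')) (φ' : StrongDual ℂ M') where
  map : M →L[ℂ] M'
  adjoint : M' →L[ℂ] M
  norm_map_le : ∀ x, ‖map x‖ ≤ ‖x‖
  norm_adjoint_le : ∀ x, ‖adjoint x‖ ≤ ‖x‖
  comp_map_mem : ∀ ψ ∈ F', ψ.comp map ∈ F
  comp_adjoint_mem : ∀ ψ ∈ F, ψ.comp adjoint ∈ F'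
  apply_map_mul : ∀ x y, φ' (map x * y) = φ (x * adjoint y)

namespace AdjointPair

/-- The pair with the two maps exchanged. -/
def symm (P : AdjointPair F φ F' φ') : AdjointPair F' φ' F φ where
  map := P.adjoint
  adjoint := P.map
  norm_map_le := P.norm_adjoint_le
  norm_adjoint_le := P.norm_map_le
  comp_map_mem := P.comp_adjoint_mem
  comp_adjoint_mem := P.comp_map_mem
  apply_map_mul x y := by rw [mul_comm, ← P.apply_map_mul, mul_comm]

variable (P : AdjointPair F φ F' φ') (p : ℝ) (hp : 1 ≤ p)

/-- The morphism of the couples `(M, M_*)` given by the map and the transpose of its adjoint. -/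
noncomputable def toContraction :
    Interp.Contraction (jtranslate φ) (Pre.toDual F) (jtranslate φ') (Pre.toDual F') where
  left := P.map
  right := preComp P.adjoint P.comp_adjoint_mem
  norm_left_le := P.norm_map_le
  norm_right_le := norm_preComp_le P.norm_adjoint_le
  compat {x _} h := ContinuousLinearMap.ext fun y =>
    (P.apply_map_mul x y).trans (DFunLike.congr_fun h (P.adjoint y))

theorem contracts_LpSub :
    (LpSub F φ p hp).Contracts (LpSub F' φ' p hp) P.toContraction.sum.toLinearMap := by
  unfold LpSub
  split_ifs
  · exact P.toContraction.contracts_right _ _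
  · exact P.toContraction.contracts_interp _

/-- The extension to `L^p` of the map of an adjoint pair. -/
noncomputable def lpMap : JLp F φ p hp →L[ℂ] JLp F' φ' p hp := (P.contracts_LpSub p hp).map

theorem norm_lpMap_le (h : JLp F φ p hp) : ‖P.lpMap p hp h‖ ≤ ‖h‖ :=
  (P.contracts_LpSub p hp).norm_map_le h

theorem val_lpMap_of_val_eq_ofAlg {h : JLp F φ p hp} {x : M} (hx : h.val = ofAlg F φ x) :
    (P.lpMap p hp h).val = ofAlg F' φ' (P.map x) :=
  ((P.contracts_LpSub p hp).val_map h).trans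
    ((congrArg P.toContraction.sum hx).trans (P.toContraction.sum_inl x))

theorem symm_lpMap_lpMap (hP : ∀ x, P.adjoint (P.map x) = x) (h : JLp F φ p hp) :
    P.symm.lpMap p hp (P.lpMap p hp h) = h :=
  Subtype.ext <| P.toContraction.sum_sum_eq_self hP
    (fun ψ => Pre.toDual_injective F <|
      ContinuousLinearMap.ext fun x => congrArg (Pre.toDual F ψ) (hP x)) h.val

/-- The isometric isomorphism of `L^p` spaces extending the map of an adjoint pair of mutually
inverse maps. -/
noncomputable def lpEquiv (hP : ∀ x, P.adjoint (P.map x) = x)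
    (hP' : ∀ y, P.map (P.adjoint y) = y) :
    JLp F φ p hp ≃ₗᵢ[ℂ] JLp F' φ' p hp :=
  .ofSurjective
    (isometryOfRetraction (P.lpMap p hp) (P.symm.lpMap p hp) (P.norm_lpMap_le p hp)
      (P.symm.norm_lpMap_le p hp) (P.symm_lpMap_lpMap p hp hP))
    (Function.LeftInverse.surjective (P.symm.symm_lpMap_lpMap p hp hP'))

/-- The adjoint pair formed by a state preserving *-isomorphism and its inverse. -/
noncomputable def ofStarAlgEquiv (hF : IsPredual F) (hφ : IsNormalFaithfulState F φ)
    (hF' : IsPredual F') (hφ' : IsNormalFaithfulState F' φ') (α : M ≃⋆ₐ[ℂ] M')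
    (hα : ∀ x, φ' (α x) = φ x) : AdjointPair F φ F' φ' :=
  have hnorm (x : M) : ‖α x‖ = ‖x‖ := by
    obtain ⟨e, he, -⟩ := hφ.exists_isJordanUnit hF
    exact norm_starAlgEquiv he α x
  let U : M ≃ₗᵢ[ℂ] M' :=
    { toFun := α, invFun := α.symm, map_add' := map_add α, map_smul' := map_smul α,
      left_inv := α.symm_apply_apply, right_inv := α.apply_symm_apply, norm_map' := hnorm }
  have hadj (x : M) (y : M') : φ' (U x * y) = φ (x * U.symm y) := by
    rw [← hα, map_mul α]
    exact congrArg (fun z => φ' (U x * z)) (U.apply_symm_apply y).symm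
  { map := U
    adjoint := U.symm
    norm_map_le := fun x => (U.norm_map x).le
    norm_adjoint_le := fun y => (U.symm.norm_map y).le
    comp_map_mem := fun ψ hψ => hφ'.comp_mem_of_adjoint hF' hφ hF
      (T := U.symm) (fun x y => by rw [mul_comm, ← hadj, mul_comm]; rfl) hψ
    comp_adjoint_mem := fun ψ hψ => hφ.comp_mem_of_adjoint hF hφ' hF' (T := U) hadj hψ
    apply_map_mul := hadj }

/-- The adjoint pair formed by the inclusion of a JBW*-subalgebra and a state preserving
contractive projection onto it. -/
noncomputable def ofProjection (hF : IsPredual F) (hφ : IsNormalFaithfulState F φ)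
    {N : JBWStarSubalgebra F} {E : M →L[ℂ] M} (hE : ∀ x, ‖E x‖ ≤ ‖x‖) (hφE : ∀ x, φ (E x) = φ x)
    (hmem : ∀ x, E x ∈ N.toSub) (hEN : ∀ x ∈ N.toSub, E x = x) :
    AdjointPair N.predual (φ.comp N.incl) F φ where
  map := N.incl
  adjoint := E.codRestrict N.toSub hmem
  norm_map_le _ := le_rfl
  norm_adjoint_le := hE
  comp_map_mem ψ hψ := ⟨ψ, hψ, rfl⟩
  comp_adjoint_mem := by
    rintro _ ⟨ψ, hψ, rfl⟩
    exact hφ.comp_mem_of_adjoint hF hφ hF (hφ.apply_map_mul hF hE hφE hmem hEN) hψ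
  apply_map_mul x y := (hφ.apply_mul_map hF hE hφE hmem hEN x.2 y).symm

end AdjointPair

end AdjointPair

section Main

variable {M : Type*} [JBStarAlgebra M] {F : Submodule ℂ (StrongDual ℂ M)} {φ : StrongDual ℂ M}
  (hF : IsPredual F) (hφ : IsNormalFaithfulState F φ) (p : ℝ) (hp : 1 ≤ p)
include hF hφ

theorem exists_isometryEquiv_induces (α : M ≃⋆ₐ[ℂ] M) (hα : ∀ x, φ (α x) = φ x) :
    ∃ αp : JLp F φ p hp ≃ₗᵢ[ℂ] JLp F φ p hp, Induces F φ p hp α αp := by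
  let P := AdjointPair.ofStarAlgEquiv hF hφ hF hφ α hα
  exact ⟨P.lpEquiv p hp α.symm_apply_apply α.apply_symm_apply, fun x =>
    ⟨⟨ofAlg F φ x, hφ.ofAlg_mem hF p hp x⟩, rfl, P.val_lpMap_of_val_eq_ofAlg p hp rfl⟩⟩

theorem exists_projection_induces {N : JBWStarSubalgebra F} {E : M →L[ℂ] M}
    (hE : ∀ x, ‖E x‖ ≤ ‖x‖) (hφE : ∀ x, φ (E x) = φ x) (hmem : ∀ x, E x ∈ N.toSub)
    (hEN : ∀ x ∈ N.toSub, E x = x) :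
    ∃ Ep : JLp F φ p hp →L[ℂ] JLp F φ p hp, Induces F φ p hp E Ep ∧ (∀ h, Ep (Ep h) = Ep h) ∧
      Nonempty (JLp N.predual (φ.comp N.incl) p hp ≃ₗᵢ[ℂ] Ep.range) := by
  let P := AdjointPair.ofProjection hF hφ hE hφE hmem hEN
  have hP : ∀ n, P.adjoint (P.map n) = n := fun n => Subtype.ext (hEN n n.2)
  refine ⟨(P.lpMap p hp).comp (P.symm.lpMap p hp), fun x => ?_, fun h => ?_,
    nonempty_isometryEquiv_range_comp (P.norm_lpMap_le p hp) (P.symm.norm_lpMap_le p hp)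
      (P.symm_lpMap_lpMap p hp hP)⟩
  · exact ⟨⟨ofAlg F φ x, hφ.ofAlg_mem hF p hp x⟩, rfl,
      P.val_lpMap_of_val_eq_ofAlg p hp (P.symm.val_lpMap_of_val_eq_ofAlg p hp rfl)⟩
  · exact congrArg (P.lpMap p hp) (P.symm_lpMap_lpMap p hp hP _)

end Main

theorem mainTheorem8_general {M : Type*} [JBStarAlgebra M]
    (F : Submodule ℂ (StrongDual ℂ M)) (hF : IsPredual F)
    (φ : StrongDual ℂ M) (hφ : IsNormalFaithfulState F φ) :
    (∀ α : M ≃⋆ₐ[ℂ] M, (∀ x, φ (α x) = φ x) →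
      ∀ (p : ℝ) (hp : 1 ≤ p), ∃ αp : JLp F φ p hp ≃ₗᵢ[ℂ] JLp F φ p hp,
        Induces F φ p hp α αp) ∧
    (∀ (N : JBWStarSubalgebra F) (E : M →L[ℂ] M), (∀ x, E (E x) = E x) → (∀ x, ‖E x‖ ≤ ‖x‖) →
      Set.range E = N.carrier → (∀ x, φ (E x) = φ x) →
      ∀ (p : ℝ) (hp : 1 ≤ p), ∃ Ep : JLp F φ p hp →L[ℂ] JLp F φ p hp,
        Induces F φ p hp E Ep ∧ (∀ h, Ep (Ep h) = Ep h) ∧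
        Nonempty (JLp N.predual (φ.comp N.incl) p hp ≃ₗᵢ[ℂ] Ep.range)) := by
  refine ⟨fun α hα p hp => exists_isometryEquiv_induces hF hφ p hp α hα,
    fun N E hidem hE hrange hφE p hp => ?_⟩
  have hmem : ∀ x, E x ∈ N.toSub := fun x => hrange.subset ⟨x, rfl⟩
  have hEN : ∀ x ∈ N.toSub, E x = x := fun x hx => by
    obtain ⟨y, rfl⟩ := hrange.superset hx
    exact hidem y
  exact exists_projection_induces hF hφ p hp hE hφE hmem hEN

theorem mainTheorem8 {M : Type*} [JBStarAlgebra M]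
    (F : Submodule ℂ (StrongDual ℂ M)) (hF : IsPredual F)
    (φ : StrongDual ℂ M) (hφ : IsNormalFaithfulState F φ) :
    (∀ α : M ≃⋆ₐ[ℂ] M, (∀ x, φ (α x) = φ x) →
      ∀ (p : ℝ) (hp : 1 ≤ p), ∃ αp : JLp F φ p hp ≃ₗᵢ[ℂ] JLp F φ p hp,
        Induces F φ p hp α αp) ∧
    (∀ (N : JBWStarSubalgebra F) (E : M →L[ℂ] M), IsNormalContractiveProj F E N →
      (∀ x, φ (E x) = φ x) →
      ∀ (p : ℝ) (hp : 1 ≤ p), ∃ Ep : JLp F φ p hp →L[ℂ] JLp F φ p hp,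
        Induces F φ p hp E Ep ∧ (∀ h, Ep (Ep h) = Ep h) ∧
        Nonempty (JLp N.predual (φ.comp N.incl) p hp ≃ₗᵢ[ℂ] Ep.range)) :=
  (mainTheorem8_general F hF φ hφ).imp_right fun h N E hE =>
    h N E hE.idem hE.contractive hE.range_eq
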